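/- Let $\mathrm{Alg}$ be the category of (associative, not necessarily unital) $\mathbb C$-algebras and algebra homomorphisms, and $\mathrm{Ab}$ the category of abelian groups. A functor $F:\mathrm{Alg}\to\mathrm{Ab}$ is *split-exact* if it sends every short exact sequence $0\to A\to B\to C\to 0$ of algebras that is split by an algebra homomorphism $C\to B$ to a short exact sequence of abelian groups; it is *$M_2$-stable* if for every algebra $A$ it sends the upper left corner inclusion $A\to M_2(A)$ to an isomorphism. A *bornological algebra* $\mathfrak B$ is a complete convex bornological vector space over $\mathbb C$ (a bornology stable under dilations in which every bounded set lies in a bounded complete disk $D$, that is, a bounded absolutely convex set $D$ whose linear span $\mathfrak B_D$ is a Banach space for the Minkowski functional $\|\cdot\|_D$ of $D$) with an associative bilinear multiplication that is bounded; $\mathrm{BAlg}$ is the category of bornological algebras and bounded homomorphisms. Let $S=c_0$ or $S=\ell^p$ with $0<p<\infty$. For a countably infinite set $X$, let $S(X,\mathfrak B)$ be the set of families $(\alpha_x)_{x\in X}$ in $\mathfrak B$ for which there is a bounded complete disk $D$ with $\alpha_x\in\mathfrak B_D$ for all $x$ and $(\|\alpha_x\|_D)_{x}\in S(X)$. Let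 $I_{S(\mathfrak B)}$ be the algebra, under matrix multiplication, of all matrices $(a_{ij})_{i,j\in\mathbb N}$ over $\mathfrak B$ such that $(a_{ij})\in S(\mathbb N\times\mathbb N,\mathfrak B)$ and the numbers of nonzero entries in the rows and in the columns are bounded. Applying bounded homomorphisms entrywise makes $\mathfrak B\mapsto I_{S(\mathfrak B)}$ a functor $\mathrm{BAlg}\to\mathrm{Alg}$. Let $C([0,1],\mathfrak B)$ be the algebra of functions that are continuous as maps into $\mathfrak B_D$ for some bounded complete disk $D$; a subset is bounded if for some $D$ it is a norm-bounded set of continuous functions into $\mathfrak B_D$. For $0<\lambda\le 1$ let $H^\lambda([0,1],\mathfrak B)$ be the algebra of functions that are $\lambda$-Hölder continuous as maps into some $\mathfrak B_D$; a subset is bounded if for some $D$ its elements are $\lambda$-Hölder continuous functions into $\mathfrak B_D$ with uniformly bounded norms and Hölder constants. A continuous (respectively $\lambda$-Hölder) homotopy between bounded homomorphisms $f_0,f_1:\mathfrak A\to\mathfrak B$ is a bounded homomorphism $H$ from $\mathfrak A$ to $C([0,1],\mathfrak B)$ (respectively to $H^\lambda([0,1],\mathfrak B)$) with $\mathrm{ev}_i\circ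 H=f_i$ for $i=0,1$. A functor on $\mathrm{BAlg}$ is invariant under such homotopies if it maps homotopic homomorphisms to equal maps. **Theorem.** Let $F:\mathrm{Alg}\to\mathrm{Ab}$ be a split-exact, $M_2$-stable functor. (i) The functor $\mathrm{BAlg}\to\mathrm{Ab}$, $\mathfrak B\mapsto F(I_{c_0(\mathfrak B)})$, is invariant under continuous homotopies. (ii) If $0<\lambda\le 1$ and $p>1/\lambda$ ($p$ real), then the functor $\mathrm{BAlg}\to\mathrm{Ab}$, $\mathfrak B\mapsto F(I_{\ell^p(\mathfrak B)})$, is invariant under $\lambda$-Hölder homotopies. -/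

import Mathlib

open CategoryTheory Filter Topology Bornology
open scoped Pointwise

universe u v

namespace BornK

noncomputable section

/-! ### Complete convex bornological vector spaces -/

section Disks

variable {V W : Type*} [AddCommGroup V] [Module ℂ V] [AddCommGroup W] [Module ℂ W]

/-- The span `V_D` of a set `D` in a complex vector space. -/
abbrev diskSpan (D : Set V) : Submodule ℂ V := Submodule.span ℂ D

/-- The norm of the space `V_D` spanned by a disk `D`: its Minkowski functional
`‖x‖_D = inf {r > 0 | x ∈ r D}`. It is only used at points of `V_D`. -/
abbrev diskNorm (D : Set V) (x : V) : ℝ := gauge D x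

/-- An absolutely convex set. -/
structure IsDisk (D : Set V) : Prop where
  nonempty : D.Nonempty
  balanced : Balanced ℂ D
  convex : Convex ℝ D

/-- A complete disk: an absolutely convex set `D` such that `(V_D, ‖·‖_D)` is a Banach space. -/
structure IsBanachDisk (D : Set V) : Prop extends IsDisk D where
  eq_zero : ∀ x ∈ diskSpan D, diskNorm D x = 0 → x = 0
  complete : ∀ x : ℕ → V, (∀ n, x n ∈ diskSpan D) →
    (∀ ε > 0, ∃ N, ∀ m ≥ N, ∀ n ≥ N, diskNorm D (x m - x n) < ε) →
    ∃ y ∈ diskSpan D, Tendsto (fun n => diskNorm D (x n - y)) atTop (𝓝 0)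

/-- A complete convex bornological vector space over `ℂ`: a bornology that is stable under
dilations and in which every bounded set lies in a bounded complete disk. -/
class CompleteBornologicalSpace (V : Type*) [AddCommGroup V] [Module ℂ V] [Bornology V] :
    Prop where
  exists_disk : ∀ s : Set V, IsBounded s → ∃ D : Set V, IsBounded D ∧ IsBanachDisk D ∧ s ⊆ D
  isBounded_smul : ∀ (c : ℂ) (s : Set V), IsBounded s → IsBounded (c • s)

theorem mem_diskSpan_of_mem_smul {D : Set V} {r : ℝ} {x : V} (h : x ∈ r • D) :
    x ∈ diskSpan D := by
  obtain ⟨d, hd, rfl⟩ := h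
  exact (Submodule.span ℂ D).smul_of_tower_mem r (Submodule.subset_span hd)

theorem IsDisk.zero_mem {D : Set V} (hD : IsDisk D) : (0 : V) ∈ D := by
  obtain ⟨d, hd⟩ := hD.nonempty
  have := hD.balanced (0 : ℂ) (by simp) (Set.smul_mem_smul_set hd)
  simpa using this

theorem IsDisk.smul_mono {D : Set V} (hD : IsDisk D) {r s : ℝ} (hr : 0 ≤ r) (hrs : r ≤ s) :
    r • D ⊆ s • D := by
  rcases hr.eq_or_lt with rfl | hr
  · rintro _ ⟨d, hd, rfl⟩
    exact ⟨0, hD.zero_mem, by simp⟩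
  · have hs : 0 < s := hr.trans_le hrs
    rintro _ ⟨d, hd, rfl⟩
    refine ⟨(r / s) • d, ?_, ?_⟩
    · exact hD.convex.smul_mem_of_zero_mem hD.zero_mem hd
        ⟨by positivity, (div_le_one hs).2 hrs⟩
    · simp only [smul_smul]
      congr 1
      field_simp

theorem IsDisk.add_mem {D : Set V} (hD : IsDisk D) {r s : ℝ} (hr : 0 ≤ r) (hs : 0 ≤ s)
    {x y : V} (hx : x ∈ r • D) (hy : y ∈ s • D) : x + y ∈ (r + s) • D := by
  rw [hD.convex.add_smul hr hs]
  exact Set.add_mem_add hx hy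

theorem IsDisk.csmul_mem {D : Set V} (hD : IsDisk D) {r : ℝ} (c : ℂ)
    {x : V} (hx : x ∈ r • D) : c • x ∈ (‖c‖ * r) • D := by
  obtain ⟨d, hd, rfl⟩ := hx
  by_cases hc : c = 0
  · subst hc
    exact ⟨0, hD.zero_mem, by simp⟩
  · have hn : (‖c‖ : ℂ) ≠ 0 := by simpa using hc
    refine ⟨(c / ‖c‖ : ℂ) • d, hD.balanced _ ?_ (Set.smul_mem_smul_set hd), ?_⟩
    · simp [hc]
    · simp only [← Complex.coe_smul, smul_smul]
      congr 1
      push_cast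
      field_simp

theorem IsDisk.exists_mem_smul {D : Set V} (hD : IsDisk D) {x : V} (hx : x ∈ diskSpan D) :
    ∃ r : ℝ, 0 < r ∧ x ∈ r • D := by
  induction hx using Submodule.span_induction with
  | mem x h => exact ⟨1, one_pos, by simpa using h⟩
  | zero => exact ⟨1, one_pos, by simpa using hD.zero_mem⟩
  | add x y _ _ hx hy =>
    obtain ⟨r, hr, hx⟩ := hx
    obtain ⟨s, hs, hy⟩ := hy
    exact ⟨r + s, by positivity, hD.add_mem hr.le hs.le hx hy⟩
  | smul c x _ hx =>
    obtain ⟨r, hr, hx⟩ := hx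
    exact ⟨‖c‖ * r + 1, by positivity,
      hD.smul_mono (by positivity) (by linarith) (hD.csmul_mem c hx)⟩

theorem IsDisk.mem_smul_of_lt {D : Set V} (hD : IsDisk D) {x : V} (hx : x ∈ diskSpan D)
    {r : ℝ} (h : diskNorm D x < r) : x ∈ r • D := by
  obtain ⟨s, hs, hxs⟩ := hD.exists_mem_smul hx
  rw [diskNorm, gauge_def] at h
  obtain ⟨t, ⟨ht, hxt⟩, htr⟩ := exists_lt_of_csInf_lt (by exact ⟨s, hs, hxs⟩) h
  exact hD.smul_mono (le_of_lt ht) htr.le hxt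

theorem diskNorm_nonneg (D : Set V) (x : V) : 0 ≤ diskNorm D x := gauge_nonneg x

theorem diskNorm_zero (D : Set V) : diskNorm D 0 = 0 := gauge_zero

theorem IsDisk.diskNorm_add_le {D : Set V} (hD : IsDisk D) {x y : V} (hx : x ∈ diskSpan D)
    (hy : y ∈ diskSpan D) : diskNorm D (x + y) ≤ diskNorm D x + diskNorm D y := by
  refine le_of_forall_pos_le_add fun ε hε => ?_
  have h1 := hD.mem_smul_of_lt hx (lt_add_of_pos_right _ (half_pos hε))
  have h2 := hD.mem_smul_of_lt hy (lt_add_of_pos_right _ (half_pos hε))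
  have nx := diskNorm_nonneg D x
  have ny := diskNorm_nonneg D y
  have := gauge_le_of_mem (by positivity) (hD.add_mem (by positivity) (by positivity) h1 h2)
  linarith

theorem IsDisk.diskNorm_sum_le {D : Set V} (hD : IsDisk D) {ι : Type*} (s : Finset ι)
    (f : ι → V) (hf : ∀ i, f i ∈ diskSpan D) :
    diskNorm D (∑ i ∈ s, f i) ≤ ∑ i ∈ s, diskNorm D (f i) := by
  classical
  induction s using Finset.induction_on with
  | empty => simp
  | insert i s hi ih =>
    rw [Finset.sum_insert hi, Finset.sum_insert hi]
    exact (hD.diskNorm_add_le (hf i) (Submodule.sum_mem _ fun j _ => hf j)).trans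
      (by linarith)

theorem IsDisk.diskNorm_smul {D : Set V} (hD : IsDisk D) (c : ℂ) (x : V) :
    diskNorm D (c • x) = ‖c‖ * diskNorm D x := gauge_smul hD.balanced c x

theorem IsDisk.diskNorm_map_le {D : Set V} {E : Set W} (hD : IsDisk D) (f : V →ₗ[ℂ] W)
    (h : ∀ x ∈ D, f x ∈ E) {x : V} (hx : x ∈ diskSpan D) :
    diskNorm E (f x) ≤ diskNorm D x := by
  refine le_of_forall_pos_le_add fun ε hε => ?_
  have nx := diskNorm_nonneg D x
  obtain ⟨d, hd, hdx⟩ := hD.mem_smul_of_lt hx (lt_add_of_pos_right _ hε)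
  refine gauge_le_of_mem (by positivity) ⟨f d, h d hd, ?_⟩
  have hdx' : ((diskNorm D x + ε : ℝ) : ℂ) • d = x := by rw [Complex.coe_smul]; exact hdx
  have := congrArg f hdx'
  rw [map_smul, Complex.coe_smul] at this
  exact this

theorem map_mem_diskSpan {D : Set V} {E : Set W} (f : V →ₗ[ℂ] W)
    (h : ∀ x ∈ D, f x ∈ E) {x : V} (hx : x ∈ diskSpan D) : f x ∈ diskSpan E := by
  have : diskSpan D ≤ (diskSpan E).comap f :=
    Submodule.span_le.2 fun d hd => Submodule.subset_span (h d hd)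
  exact this hx

theorem IsDisk.diskNorm_mono {D E : Set V} (hD : IsDisk D) (h : D ⊆ E) {x : V}
    (hx : x ∈ diskSpan D) : diskNorm E x ≤ diskNorm D x :=
  hD.diskNorm_map_le LinearMap.id h hx

end Disks

/-! ### Bornological algebras -/

/-- A (not necessarily unital) bornological algebra: a complete convex bornological vector space
with a bounded associative bilinear multiplication. -/
class BornologicalAlgebra (A : Type*) [NonUnitalRing A] [Module ℂ A] [Bornology A] : Prop
    extends CompleteBornologicalSpace A, IsScalarTower ℂ A A, SMulCommClass ℂ A A where
  isBounded_mul : ∀ s t : Set A, IsBounded s → IsBounded t → IsBounded (s * t)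

section MulDisk

variable {A : Type*} [NonUnitalRing A] [Module ℂ A] [IsScalarTower ℂ A A] [SMulCommClass ℂ A A]

theorem mul_mem_diskSpan {D D' E : Set A} (h : D * D' ⊆ E) {x y : A} (hx : x ∈ diskSpan D)
    (hy : y ∈ diskSpan D') : x * y ∈ diskSpan E := by
  induction hx using Submodule.span_induction with
  | mem d hd =>
    exact map_mem_diskSpan (LinearMap.mulLeft ℂ d) (fun y hy => h (Set.mul_mem_mul hd hy)) hy
  | zero => simp
  | add a b _ _ ha hb => rw [add_mul]; exact add_mem ha hb
  | smul c a _ ha => rw [smul_mul_assoc]; exact Submodule.smul_mem _ c ha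

theorem diskNorm_mul_le {D D' E : Set A} (hD : IsDisk D) (hD' : IsDisk D') (h : D * D' ⊆ E)
    {x y : A} (hx : x ∈ diskSpan D) (hy : y ∈ diskSpan D') :
    diskNorm E (x * y) ≤ diskNorm D x * diskNorm D' y := by
  have key : ∀ r > diskNorm D x, ∀ s > diskNorm D' y, diskNorm E (x * y) ≤ r * s := by
    intro r hr s hs
    have hr0 := (diskNorm_nonneg D x).trans_lt hr
    have hs0 := (diskNorm_nonneg D' y).trans_lt hs
    obtain ⟨a, ha, rfl⟩ := hD.mem_smul_of_lt hx hr
    obtain ⟨b, hb, rfl⟩ := hD'.mem_smul_of_lt hy hs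
    refine gauge_le_of_mem (by positivity) ⟨a * b, h (Set.mul_mem_mul ha hb), ?_⟩
    simp only [← Complex.coe_smul, smul_mul_assoc, mul_smul_comm, smul_smul]
    push_cast
    rw [mul_comm]
  have nx := diskNorm_nonneg D x
  have ny := diskNorm_nonneg D' y
  have h1 : Tendsto (fun ε : ℝ => (diskNorm D x + ε) * (diskNorm D' y + ε)) (𝓝[>] 0)
      (𝓝 ((diskNorm D x + 0) * (diskNorm D' y + 0))) := by
    refine Tendsto.mono_left ?_ nhdsWithin_le_nhds
    exact Continuous.tendsto (by fun_prop) 0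
  rw [add_zero, add_zero] at h1
  refine ge_of_tendsto h1 ?_
  filter_upwards [self_mem_nhdsWithin] with ε hε
  exact key _ (lt_add_of_pos_right _ hε) _ (lt_add_of_pos_right _ hε)

end MulDisk

/-! ### The categories -/

/-- The category of not necessarily unital associative `ℂ`-algebras: objects. -/
structure Alg : Type (u + 1) where
  carrier : Type u
  [ring : NonUnitalRing carrier]
  [module : Module ℂ carrier]
  [tower : IsScalarTower ℂ carrier carrier]
  [comm : SMulCommClass ℂ carrier carrier]

attribute [instance] Alg.ring Alg.module Alg.tower Alg.comm

/-- Morphisms are the (not necessarily unital) algebra homomorphisms. -/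
instance : Category Alg.{u} where
  Hom A B := A.carrier →ₙₐ[ℂ] B.carrier
  id A := NonUnitalAlgHom.id ℂ A.carrier
  comp f g := NonUnitalAlgHom.comp g f

/-- An algebra homomorphism as a morphism of `Alg`. -/
def Alg.ofHom {A B : Type u} [NonUnitalRing A] [Module ℂ A] [IsScalarTower ℂ A A]
    [SMulCommClass ℂ A A] [NonUnitalRing B] [Module ℂ B] [IsScalarTower ℂ B B]
    [SMulCommClass ℂ B B] (f : A →ₙₐ[ℂ] B) : Alg.mk A ⟶ Alg.mk B := f

/-- The underlying algebra homomorphism of a morphism of `Alg`. -/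
def Alg.toHom {A B : Alg.{u}} (f : A ⟶ B) : A.carrier →ₙₐ[ℂ] B.carrier := f

/-- The category of bornological algebras: objects. -/
structure BornAlg : Type (u + 1) where
  carrier : Type u
  [ring : NonUnitalRing carrier]
  [module : Module ℂ carrier]
  [bornology : Bornology carrier]
  [isBornologicalAlgebra : BornologicalAlgebra carrier]

attribute [instance] BornAlg.ring BornAlg.module BornAlg.bornology BornAlg.isBornologicalAlgebra

/-- A bounded algebra homomorphism. -/
@[ext]
structure BornAlg.Hom (A B : BornAlg.{u}) : Type u where
  toHom : A.carrier →ₙₐ[ℂ] B.carrier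
  isBounded_image : ∀ s : Set A.carrier, IsBounded s → IsBounded (toHom '' s)

/-- Morphisms of bornological algebras are the bounded algebra homomorphisms. -/
instance : Category BornAlg.{u} where
  Hom A B := BornAlg.Hom A B
  id A := ⟨NonUnitalAlgHom.id ℂ A.carrier, fun s hs => by
    have : (NonUnitalAlgHom.id ℂ A.carrier) '' s = s := by simp
    rwa [this]⟩
  comp f g := ⟨NonUnitalAlgHom.comp g.toHom f.toHom, fun s hs => by
    have : (NonUnitalAlgHom.comp g.toHom f.toHom) '' s = g.toHom '' (f.toHom '' s) := by
      rw [Set.image_image]; rfl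
    rw [this]
    exact g.isBounded_image _ (f.isBounded_image _ hs)⟩

/-! ### Symmetric ideals of bounded sequences -/

/-- The action `f_*` of a partially defined injection `f` of `ℕ` on sequences:
`f_*(α)_n = α_{f⁻¹(n)}` if `n` is in the range of `f`, and `0` otherwise. -/
def pushSeq (f : ℕ ≃. ℕ) (α : ℕ → ℂ) : ℕ → ℂ := fun n => (f.symm n).elim 0 α

/-- A symmetric ideal of `ℓ^∞`: an ideal of the algebra of bounded complex sequences that is
invariant under all partially defined injections of `ℕ`. -/
structure SymmIdeal where
  carrier : Set (ℕ → ℂ)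
  bounded : ∀ α ∈ carrier, ∃ C : ℝ, ∀ n, ‖α n‖ ≤ C
  zero_mem : 0 ∈ carrier
  add_mem : ∀ α ∈ carrier, ∀ β ∈ carrier, α + β ∈ carrier
  mul_mem : ∀ β : ℕ → ℂ, (∃ C : ℝ, ∀ n, ‖β n‖ ≤ C) → ∀ α ∈ carrier, β * α ∈ carrier
  push_mem : ∀ f : ℕ ≃. ℕ, ∀ α ∈ carrier, pushSeq f α ∈ carrier

/-- The symmetric ideal `c_0` of sequences converging to zero. -/
def c0 : SymmIdeal where
  carrier := {α | Tendsto α atTop (𝓝 0)}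
  bounded α hα := by
    obtain ⟨C, hC⟩ := (Metric.isBounded_range_of_tendsto α hα).exists_norm_le
    exact ⟨C, fun n => hC _ ⟨n, rfl⟩⟩
  zero_mem := tendsto_const_nhds
  add_mem α hα β hβ := by
    have := Tendsto.add hα hβ
    rw [add_zero] at this
    exact this
  mul_mem β hβ α hα := by
    obtain ⟨C, hC⟩ := hβ
    have h : Tendsto (fun n => C * ‖α n‖) atTop (𝓝 0) := by
      simpa using (tendsto_zero_iff_norm_tendsto_zero.1 hα).const_mul C
    refine squeeze_zero_norm (fun n => ?_) h
    rw [Pi.mul_apply, norm_mul]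
    exact mul_le_mul_of_nonneg_right (hC n) (norm_nonneg _)
  push_mem f α hα := by
    simp only [Set.mem_ofPred_eq, ← Nat.cofinite_eq_atTop] at hα ⊢
    rw [Metric.tendsto_nhds] at hα ⊢
    intro ε hε
    have h := hα ε hε
    rw [Filter.eventually_cofinite] at h ⊢
    refine (h.image fun m => (f m).getD 0).subset ?_
    intro n hn
    simp only [Set.mem_ofPred_eq, pushSeq] at hn
    rcases hm : f.symm n with _ | m
    · rw [hm] at hn; simp [hε] at hn
    · rw [hm] at hn
      have hfm : f m = some n := (PEquiv.eq_some_iff f).1 hm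
      exact ⟨m, hn, by simp [hfm]⟩

/-- The symmetric ideal `ℓ^p` (`0 < p < ∞`) of `p`-summable sequences. -/
def lp (p : ℝ) (hp : 0 < p) : SymmIdeal where
  carrier := {α | Summable fun n => ‖α n‖ ^ p}
  bounded α hα := by
    obtain ⟨C, hC⟩ := (Metric.isBounded_range_of_tendsto _
      (Summable.tendsto_atTop_zero hα)).exists_norm_le
    refine ⟨C ^ p⁻¹, fun n => ?_⟩
    have h := hC _ ⟨n, rfl⟩
    rw [Real.norm_of_nonneg (by positivity)] at h
    calc ‖α n‖ = (‖α n‖ ^ p) ^ p⁻¹ := (Real.rpow_rpow_inv (norm_nonneg _) hp.ne').symm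
      _ ≤ C ^ p⁻¹ := Real.rpow_le_rpow (by positivity) h (by positivity)
  zero_mem := by simp [Real.zero_rpow hp.ne', summable_zero]
  add_mem α hα β hβ := by
    refine Summable.of_nonneg_of_le (fun n => by positivity) (fun n => ?_)
      ((Summable.add hα hβ).mul_left (2 ^ p))
    have h0 : ‖(α + β) n‖ ≤ 2 * max ‖α n‖ ‖β n‖ := by
      refine (norm_add_le _ _).trans ?_
      have := le_max_left ‖α n‖ ‖β n‖
      have := le_max_right ‖α n‖ ‖β n‖
      linarith
    refine (Real.rpow_le_rpow (norm_nonneg _) h0 hp.le).trans ?_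
    rw [Real.mul_rpow (by norm_num) (by positivity)]
    refine mul_le_mul_of_nonneg_left ?_ (by positivity)
    have ha : 0 ≤ ‖α n‖ ^ p := by positivity
    have hb : 0 ≤ ‖β n‖ ^ p := by positivity
    rcases max_cases ‖α n‖ ‖β n‖ with ⟨h, _⟩ | ⟨h, _⟩ <;> rw [h] <;> linarith
  mul_mem β hβ α hα := by
    obtain ⟨C, hC⟩ := hβ
    refine Summable.of_nonneg_of_le (fun n => by positivity) (fun n => ?_)
      (Summable.mul_left (C ^ p) hα)
    have hC0 : 0 ≤ C := (norm_nonneg _).trans (hC n)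
    rw [← Real.mul_rpow hC0 (norm_nonneg _), Pi.mul_apply, norm_mul]
    exact Real.rpow_le_rpow (by positivity)
      (mul_le_mul_of_nonneg_right (hC n) (norm_nonneg _)) hp.le
  push_mem f α hα := by
    simp only [Set.mem_ofPred_eq] at hα ⊢
    let s : Set ℕ := {n | ∃ m, f.symm n = some m}
    let g : s → ℕ := fun n => n.2.choose
    have hg : ∀ n : s, f.symm n = some (g n) := fun n => n.2.choose_spec
    have hinj : Function.Injective g := by
      intro a b hab
      have h1 := (PEquiv.eq_some_iff f).1 (hg a)
      have h2 := (PEquiv.eq_some_iff f).1 (hg b)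
      rw [hab, h2] at h1
      exact Subtype.ext (Option.some.inj h1).symm
    have h1 : Summable ((fun n => ‖pushSeq f α n‖ ^ p) ∘ (Subtype.val : s → ℕ)) := by
      refine (hα.comp_injective hinj).congr fun n => ?_
      simp [pushSeq, hg n]
    refine (Function.Injective.summable_iff Subtype.val_injective fun n hn => ?_).1 h1
    have : f.symm n = none := by
      rcases hm : f.symm n with _ | m
      · rfl
      · exact absurd ⟨⟨n, m, hm⟩, rfl⟩ hn
    simp [pushSeq, this, Real.zero_rpow hp.ne']

namespace SymmIdeal

variable (S : SymmIdeal)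

theorem mem_of_norm_le {α β : ℕ → ℂ} (hα : α ∈ S.carrier) (h : ∀ n, ‖β n‖ ≤ ‖α n‖) :
    β ∈ S.carrier := by
  have hb : β = (fun n => β n / α n) * α := by
    funext n
    by_cases h0 : α n = 0
    · have := h n
      rw [h0, norm_zero, norm_le_zero_iff] at this
      simp [this]
    · simp [h0]
  rw [hb]
  refine S.mul_mem _ ⟨1, fun n => ?_⟩ _ hα
  rw [norm_div]
  exact div_le_one_of_le₀ (h n) (norm_nonneg _)

theorem smul_mem (c : ℂ) {α : ℕ → ℂ} (hα : α ∈ S.carrier) : (fun n => c * α n) ∈ S.carrier :=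
  S.mul_mem (fun _ => c) ⟨‖c‖, fun _ => le_rfl⟩ α hα

theorem sum_mem {ι : Type*} (s : Finset ι) (f : ι → ℕ → ℂ) (hf : ∀ i ∈ s, f i ∈ S.carrier) :
    (∑ i ∈ s, f i) ∈ S.carrier := by
  classical
  induction s using Finset.induction_on with
  | empty => exact S.zero_mem
  | insert i s hi ih =>
    rw [Finset.sum_insert hi]
    exact S.add_mem _ (hf i (by simp)) _ (ih fun j hj => hf j (by simp [hj]))

theorem indicator_mem {α : ℕ → ℂ} (hα : α ∈ S.carrier) (B : Set ℕ) (g : ℕ → ℕ)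
    (hg : Set.InjOn g B) : B.indicator (fun n => α (g n)) ∈ S.carrier := by
  classical
  let f : ℕ ≃. ℕ :=
    { toFun := fun m => if h : ∃ n, n ∈ B ∧ g n = m then some h.choose else none
      invFun := fun n => if n ∈ B then some (g n) else none
      inv := by
        intro m n
        by_cases h : ∃ n, n ∈ B ∧ g n = m
        · have hs := h.choose_spec
          simp only [h, dite_true, Option.some.injEq]
          constructor
          · intro hn
            by_cases hB : n ∈ B
            · simp only [hB, if_true, Option.some.injEq] at hn
              exact hg hs.1 hB (hs.2.trans hn.symm)
            · simp [hB] at hn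
          · rintro rfl
            simp [hs.1, hs.2]
        · simp only [h, dite_false]
          constructor
          · intro hn
            by_cases hB : n ∈ B
            · simp only [hB, if_true, Option.some.injEq] at hn
              exact absurd ⟨n, hB, hn⟩ h
            · simp [hB] at hn
          · intro hn; simp at hn }
  have := S.push_mem f α hα
  convert this using 1
  funext n
  change _ = (if n ∈ B then some (g n) else none : Option ℕ).elim 0 α
  by_cases hB : n ∈ B <;> simp [hB]

theorem finiteToOne_mem {α : ℕ → ℂ} (hα : α ∈ S.carrier) (B : Set ℕ) (g : ℕ → ℕ) (N : ℕ)
    (hg : ∀ m, {n | n ∈ B ∧ g n = m}.encard ≤ N) :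
    B.indicator (fun n => α (g n)) ∈ S.carrier := by
  classical
  let r : ℕ → ℕ := fun n => ((Finset.range n).filter fun k => k ∈ B ∧ g k = g n).card
  have hr : ∀ n ∈ B, r n < N := by
    intro n hn
    have hsub : (↑(insert n ((Finset.range n).filter fun k => k ∈ B ∧ g k = g n)) : Set ℕ) ⊆
        {k | k ∈ B ∧ g k = g n} := by
      intro k hk
      simp only [Finset.coe_insert, Set.mem_insert_iff, Finset.mem_coe, Finset.mem_filter] at hk
      rcases hk with rfl | hk
      · exact ⟨hn, rfl⟩
      · exact hk.2
    have h := (Set.encard_le_encard hsub).trans (hg (g n))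
    rw [Set.encard_coe_eq_coe_finsetCard, Finset.card_insert_of_notMem (by simp)] at h
    have h' : r n + 1 ≤ N := by exact_mod_cast h
    exact h'
  have hinj : ∀ t, Set.InjOn g {n | n ∈ B ∧ r n = t} := by
    have aux : ∀ a b, a ∈ B → g a = g b → a < b → r a < r b := by
      intro a b ha hab hlt
      refine Finset.card_lt_card ?_
      rw [Finset.ssubset_iff_of_subset]
      · exact ⟨a, by simp [ha, hab, hlt], by simp⟩
      · intro k hk
        simp only [Finset.mem_filter, Finset.mem_range] at hk ⊢
        exact ⟨hk.1.trans hlt, hk.2.1, hk.2.2.trans hab⟩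
    rintro t a ⟨ha, hat⟩ b ⟨hb, hbt⟩ hab
    rcases lt_trichotomy a b with h | h | h
    · have := aux a b ha hab h; omega
    · exact h
    · have := aux b a hb hab.symm h; omega
  have hsum := S.sum_mem (Finset.range N)
    (fun t => {n | n ∈ B ∧ r n = t}.indicator fun n => α (g n))
    (fun t _ => S.indicator_mem hα _ g (hinj t))
  convert hsum using 1
  funext n
  rw [Finset.sum_apply]
  by_cases hB : n ∈ B
  · simp [Set.indicator_apply, hB, hr n hB]
  · simp [hB]

/-- The space `S(V)` of sequences `α` in a bornological space `V` for which there is a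
bounded complete disk `D` such that `α` takes values in `V_D` and `‖α‖_D ∈ S`. -/
def seq (V : Type*) [AddCommGroup V] [Module ℂ V] [Bornology V] : Set (ℕ → V) :=
  {α | ∃ D : Set V, IsBounded D ∧ IsBanachDisk D ∧ (∀ n, α n ∈ diskSpan D) ∧
    (fun n => (diskNorm D (α n) : ℂ)) ∈ S.carrier}

/-- The space `S(X, V)` of families indexed by a countably infinite set `X`, transported from
`S(V)` along an enumeration `e` of `X`. -/
def seqOn {X : Type*} (e : ℕ ≃ X) (V : Type*) [AddCommGroup V] [Module ℂ V] [Bornology V] :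
    Set (X → V) :=
  {α | (fun n => α (e n)) ∈ S.seq V}

end SymmIdeal

/-! ### The algebras `I_{S(A)}` -/

/-- `N(a) < ∞`: the numbers of nonzero entries in the rows and in the columns of the infinite
matrix `a` are bounded. -/
def RowColBounded {A : Type*} [Zero A] (a : ℕ → ℕ → A) : Prop :=
  ∃ N : ℕ, (∀ i, {j | a i j ≠ 0}.encard ≤ N) ∧ ∀ j, {i | a i j ≠ 0}.encard ≤ N

/-- Membership in `I_{S(A)}`: an `ℕ × ℕ`-matrix `a` with entries in `A` such that
`N(a) < ∞` and the family of its entries belongs to `S(ℕ × ℕ, A)`. -/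
def MemI (S : SymmIdeal) {A : Type*} [AddCommGroup A] [Module ℂ A] [Bornology A]
    (a : ℕ → ℕ → A) : Prop :=
  RowColBounded a ∧ (fun ij : ℕ × ℕ => a ij.1 ij.2) ∈ S.seqOn Nat.pairEquiv.symm A

/-- Multiplication of infinite matrices (for matrices with finitely many nonzero entries in
every row and every column, so that the sums are finite). -/
def matMul {A : Type*} [NonUnitalRing A] (a b : ℕ → ℕ → A) : ℕ → ℕ → A :=
  fun i k => ∑ᶠ j, a i j * b j k

section RowCol

variable {A : Type*} [NonUnitalRing A]

theorem RowColBounded.row_finite {a : ℕ → ℕ → A} (h : RowColBounded a) (i : ℕ) :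
    {j | a i j ≠ 0}.Finite := by
  obtain ⟨N, h1, _⟩ := h
  exact Set.finite_of_encard_le_coe (h1 i)

theorem RowColBounded.col_finite {a : ℕ → ℕ → A} (h : RowColBounded a) (j : ℕ) :
    {i | a i j ≠ 0}.Finite := by
  obtain ⟨N, _, h1⟩ := h
  exact Set.finite_of_encard_le_coe (h1 j)

theorem matMul_eq_sum_row {a : ℕ → ℕ → A} (b : ℕ → ℕ → A) (i k : ℕ) (s : Finset ℕ)
    (hs : ∀ j, a i j ≠ 0 → j ∈ s) : matMul a b i k = ∑ j ∈ s, a i j * b j k := by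
  refine finsum_eq_sum_of_support_subset _ fun j hj => hs j ?_
  rintro h0
  exact hj (by simp [h0])

theorem matMul_eq_sum_col (a : ℕ → ℕ → A) {b : ℕ → ℕ → A} (i k : ℕ) (s : Finset ℕ)
    (hs : ∀ j, b j k ≠ 0 → j ∈ s) : matMul a b i k = ∑ j ∈ s, a i j * b j k := by
  refine finsum_eq_sum_of_support_subset _ fun j hj => hs j ?_
  rintro h0
  exact hj (by simp [h0])

theorem RowColBounded.add {a b : ℕ → ℕ → A} (ha : RowColBounded a) (hb : RowColBounded b) :
    RowColBounded (a + b) := by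
  obtain ⟨N, h1, h2⟩ := ha
  obtain ⟨M, h3, h4⟩ := hb
  refine ⟨N + M, fun i => ?_, fun j => ?_⟩
  · have : {j | (a + b) i j ≠ 0} ⊆ {j | a i j ≠ 0} ∪ {j | b i j ≠ 0} := by
      intro j hj
      by_contra hcon
      simp only [Set.mem_union, Set.mem_ofPred_eq, not_or, not_not] at hcon
      exact hj (by simp [hcon.1, hcon.2])
    refine (Set.encard_le_encard this).trans ((Set.encard_union_le _ _).trans ?_)
    push_cast
    exact add_le_add (h1 i) (h3 i)
  · have : {i | (a + b) i j ≠ 0} ⊆ {i | a i j ≠ 0} ∪ {i | b i j ≠ 0} := by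
      intro i hi
      by_contra hcon
      simp only [Set.mem_union, Set.mem_ofPred_eq, not_or, not_not] at hcon
      exact hi (by simp [hcon.1, hcon.2])
    refine (Set.encard_le_encard this).trans ((Set.encard_union_le _ _).trans ?_)
    push_cast
    exact add_le_add (h2 j) (h4 j)

theorem RowColBounded.of_zero {B : Type*} [Zero B] {a : ℕ → ℕ → A} {b : ℕ → ℕ → B}
    (ha : RowColBounded a) (h : ∀ i j, a i j = 0 → b i j = 0) : RowColBounded b := by
  obtain ⟨N, h1, h2⟩ := ha
  have h' : ∀ i j, b i j ≠ 0 → a i j ≠ 0 := fun i j hb h0 => hb (h i j h0)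
  exact ⟨N, fun i => (Set.encard_le_encard fun j hj => h' i j hj).trans (h1 i),
    fun j => (Set.encard_le_encard fun i hi => h' i j hi).trans (h2 j)⟩

theorem encard_biUnion_le {N M : ℕ} {s : Set ℕ} (hs : s.encard ≤ N) (t : ℕ → Set ℕ)
    (ht : ∀ j, (t j).encard ≤ M) : (⋃ j ∈ s, t j).encard ≤ (N * M : ℕ) := by
  classical
  have hfin : s.Finite := Set.finite_of_encard_le_coe hs
  have htf : ∀ j, (t j).Finite := fun j => Set.finite_of_encard_le_coe (ht j)
  have h : (⋃ j ∈ s, t j) = ↑(hfin.toFinset.biUnion fun j => (htf j).toFinset) := by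
    ext x; simp
  rw [h, Set.encard_coe_eq_coe_finsetCard]
  have hc : hfin.toFinset.card ≤ N := by
    rw [hfin.encard_eq_coe_toFinset_card] at hs
    exact_mod_cast hs
  have hm : ∀ j ∈ hfin.toFinset, ((htf j).toFinset).card ≤ M := fun j _ => by
    have := ht j
    rw [(htf j).encard_eq_coe_toFinset_card] at this
    exact_mod_cast this
  exact_mod_cast (Finset.card_biUnion_le_card_mul _ _ M hm).trans (Nat.mul_le_mul_right M hc)

theorem RowColBounded.mul {a b : ℕ → ℕ → A} (ha : RowColBounded a) (hb : RowColBounded b) :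
    RowColBounded (matMul a b) := by
  obtain ⟨N, h1, h2⟩ := ha
  obtain ⟨M, h3, h4⟩ := hb
  have key : ∀ i k, matMul a b i k ≠ 0 → ∃ j, a i j ≠ 0 ∧ b j k ≠ 0 := by
    intro i k h
    obtain ⟨j, hj⟩ : ∃ j, a i j * b j k ≠ 0 := by
      by_contra! hcon
      exact h (by simp [matMul, hcon])
    exact ⟨j, fun h0 => hj (by simp [h0]), fun h0 => hj (by simp [h0])⟩
  refine ⟨N * M, fun i => ?_, fun k => ?_⟩
  · refine (Set.encard_le_encard ?_).trans (encard_biUnion_le (h1 i) _ h3)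
    intro k hk
    obtain ⟨j, hj, hjk⟩ := key i k hk
    simp only [Set.mem_iUnion]
    exact ⟨j, hj, hjk⟩
  · rw [mul_comm]
    refine (Set.encard_le_encard ?_).trans (encard_biUnion_le (h4 k) _ h2)
    intro i hi
    obtain ⟨j, hj, hjk⟩ := key i k hi
    simp only [Set.mem_iUnion]
    exact ⟨j, hjk, hj⟩

theorem matMul_assoc {a b c : ℕ → ℕ → A} (ha : RowColBounded a) (hc : RowColBounded c) :
    matMul (matMul a b) c = matMul a (matMul b c) := by
  funext i l
  have hJ : ∀ j, a i j ≠ 0 → j ∈ (ha.row_finite i).toFinset := fun j hj => by simpa using hj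
  have hK : ∀ k, c k l ≠ 0 → k ∈ (hc.col_finite l).toFinset := fun k hk => by simpa using hk
  rw [matMul_eq_sum_col (matMul a b) i l _ hK, matMul_eq_sum_row (matMul b c) i l _ hJ]
  simp_rw [matMul_eq_sum_row b i _ _ hJ, matMul_eq_sum_col b _ l _ hK, Finset.sum_mul,
    Finset.mul_sum, mul_assoc]
  exact Finset.sum_comm

end RowCol

section ISA

variable (S : SymmIdeal) {A : Type*} [NonUnitalRing A] [Module ℂ A] [Bornology A]
  [BornologicalAlgebra A]

theorem exists_bounded_disk {V : Type*} [AddCommGroup V] [Module ℂ V] [Bornology V]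
    [CompleteBornologicalSpace V] (s : Set V) (hs : IsBounded s) :
    ∃ D : Set V, IsBounded D ∧ IsBanachDisk D ∧ s ⊆ D :=
  CompleteBornologicalSpace.exists_disk s hs

theorem MemI.zero : MemI S (0 : ℕ → ℕ → A) := by
  refine ⟨⟨0, by simp, by simp⟩, ?_⟩
  obtain ⟨D, hD, hD', -⟩ := exists_bounded_disk (V := A) ∅ isBounded_empty
  refine ⟨D, hD, hD', fun n => Submodule.zero_mem _, ?_⟩
  convert S.zero_mem using 1
  funext n
  simp

variable {S}

theorem MemI.add {a b : ℕ → ℕ → A} (ha : MemI S a) (hb : MemI S b) : MemI S (a + b) := by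
  obtain ⟨ha, D, hD, hD', haD, haS⟩ := ha
  obtain ⟨hb, E, hE, hE', hbE, hbS⟩ := hb
  obtain ⟨G, hG, hG', hsub⟩ := exists_bounded_disk (D ∪ E) (hD.union hE)
  have hDG : D ⊆ G := Set.subset_union_left.trans hsub
  have hEG : E ⊆ G := Set.subset_union_right.trans hsub
  have haG := fun n => Submodule.span_mono (R := ℂ) hDG (haD n)
  have hbG := fun n => Submodule.span_mono (R := ℂ) hEG (hbE n)
  refine ⟨ha.add hb, G, hG, hG', fun n => add_mem (haG n) (hbG n), ?_⟩
  refine S.mem_of_norm_le (S.add_mem _ haS _ hbS) fun n => ?_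
  rw [Pi.add_apply, ← Complex.ofReal_add, Complex.norm_real, Complex.norm_real,
    Real.norm_of_nonneg (diskNorm_nonneg _ _),
    Real.norm_of_nonneg (add_nonneg (diskNorm_nonneg _ _) (diskNorm_nonneg _ _))]
  exact (hG'.toIsDisk.diskNorm_add_le (haG n) (hbG n)).trans
    (add_le_add (hD'.toIsDisk.diskNorm_mono hDG (haD n))
      (hE'.toIsDisk.diskNorm_mono hEG (hbE n)))

theorem MemI.smul (c : ℂ) {a : ℕ → ℕ → A} (ha : MemI S a) : MemI S (c • a) := by
  obtain ⟨ha, D, hD, hD', haD, haS⟩ := ha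
  refine ⟨ha.of_zero fun i j h => by simp [h], D, hD, hD',
    fun n => Submodule.smul_mem _ c (haD n), ?_⟩
  refine S.mem_of_norm_le (S.smul_mem c haS) fun n => ?_
  simp only [Pi.smul_apply]
  rw [hD'.toIsDisk.diskNorm_smul, norm_mul]
  simp

theorem MemI.mul {a b : ℕ → ℕ → A} (ha : MemI S a) (hb : MemI S b) : MemI S (matMul a b) := by
  classical
  obtain ⟨ha, D, hD, hD', haD, haS⟩ := ha
  obtain ⟨hb, E, hE, hE', hbE, hbS⟩ := hb
  obtain ⟨G, hG, hG', hsub⟩ := exists_bounded_disk (D * E)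
    (BornologicalAlgebra.isBounded_mul D E hD hE)
  have haD' : ∀ i j, a i j ∈ diskSpan D := fun i j => by
    simpa using haD (Nat.pairEquiv (i, j))
  have hbE' : ∀ i j, b i j ∈ diskSpan E := fun i j => by
    simpa using hbE (Nat.pairEquiv (i, j))
  obtain ⟨C, hC⟩ := S.bounded _ hbS
  have hC' : ∀ i j, diskNorm E (b i j) ≤ C := fun i j => by
    have := hC (Nat.pairEquiv (i, j))
    simpa [Complex.norm_real, abs_of_nonneg (diskNorm_nonneg E _)] using this
  have hC0 : 0 ≤ C := (diskNorm_nonneg _ _).trans (hC' 0 0)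
  have hab : ∀ i j k, a i j * b j k ∈ diskSpan G := fun i j k =>
    mul_mem_diskSpan hsub (haD' i j) (hbE' j k)
  refine ⟨ha.mul hb, G, hG, hG', fun n => ?_, ?_⟩
  · change matMul a b n.unpair.1 n.unpair.2 ∈ diskSpan G
    generalize n.unpair.1 = i
    generalize n.unpair.2 = k
    rw [matMul_eq_sum_row b i k (ha.row_finite i).toFinset fun j hj => by simpa using hj]
    exact Submodule.sum_mem _ fun j _ => hab i j k
  · have hbf := hb.col_finite
    obtain ⟨N, hrow, hcol⟩ := hb
    let s : ℕ → Finset ℕ := fun k => (hbf k).toFinset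
    have hmem : ∀ j k, j ∈ s k ↔ b j k ≠ 0 := fun j k => by simp [s]
    have hcard : ∀ k, (s k).card ≤ N := fun k => by
      have := hcol k
      rw [(hbf k).encard_eq_coe_toFinset_card] at this
      exact_mod_cast this
    let e : ℕ → ℕ → ℕ := fun k t => (s k).toList.getD t 0
    have he : ∀ k, ∀ j ∈ s k, ∃ t < N, e k t = j := by
      intro k j hj
      obtain ⟨t, ht, htj⟩ := List.mem_iff_getElem.1 (Finset.mem_toList.2 hj)
      refine ⟨t, ?_, ?_⟩
      · rw [Finset.length_toList] at ht
        exact ht.trans_le (hcard k)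
      · simp only [e]
        rw [List.getD_eq_getElem _ _ ht, htj]
    let α : ℕ → ℂ := fun n => (diskNorm D (a n.unpair.1 n.unpair.2) : ℂ)
    have hα : α ∈ S.carrier := haS
    let B : ℕ → Set ℕ := fun t => {n | b (e n.unpair.2 t) n.unpair.2 ≠ 0}
    let φ : ℕ → ℕ → ℕ := fun t n => Nat.pair n.unpair.1 (e n.unpair.2 t)
    have hfib : ∀ t m, {n | n ∈ B t ∧ φ t n = m}.encard ≤ N := by
      intro t m
      refine le_trans ?_ (hrow m.unpair.2)
      have hinj : Set.InjOn (fun n : ℕ => n.unpair.2) {n | n ∈ B t ∧ φ t n = m} := by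
        rintro x ⟨-, hx⟩ y ⟨-, hy⟩ hxy
        have h1 : x.unpair.1 = m.unpair.1 := by rw [← hx]; simp [φ]
        have h2 : y.unpair.1 = m.unpair.1 := by rw [← hy]; simp [φ]
        rw [← Nat.pair_unpair x, ← Nat.pair_unpair y, h1, h2]
        congr 1
      rw [← hinj.encard_image]
      refine Set.encard_le_encard ?_
      rintro _ ⟨n, ⟨hn, hnm⟩, rfl⟩
      have : m.unpair.2 = e n.unpair.2 t := by rw [← hnm]; simp [φ]
      simp only [Set.mem_ofPred_eq, this]
      exact hn
    have hS := S.smul_mem (C : ℂ) (S.sum_mem (Finset.range N)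
      (fun t => (B t).indicator fun n => α (φ t n))
      (fun t _ => S.finiteToOne_mem hα (B t) (φ t) N (hfib t)))
    refine S.mem_of_norm_le hS fun n => ?_
    have hrhs : (C : ℂ) * (∑ t ∈ Finset.range N, (B t).indicator fun n => α (φ t n)) n
        = ((C * ∑ t ∈ Finset.range N, if n ∈ B t then
            diskNorm D (a n.unpair.1 (e n.unpair.2 t)) else 0 : ℝ) : ℂ) := by
      rw [Finset.sum_apply]
      push_cast
      congr 1
      refine Finset.sum_congr rfl fun t _ => ?_
      by_cases h : n ∈ B t <;> simp [h, α, φ]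
    have hnn : ∀ t, 0 ≤ if n ∈ B t then diskNorm D (a n.unpair.1 (e n.unpair.2 t)) else 0 := by
      intro t
      split_ifs
      · exact diskNorm_nonneg _ _
      · exact le_rfl
    rw [hrhs, Complex.norm_real, Complex.norm_real, Real.norm_of_nonneg (diskNorm_nonneg _ _),
      Real.norm_of_nonneg (mul_nonneg hC0 (Finset.sum_nonneg fun t _ => hnn t))]
    change diskNorm G (matMul a b n.unpair.1 n.unpair.2) ≤ _
    obtain ⟨i, hi⟩ : ∃ i, n.unpair.1 = i := ⟨_, rfl⟩
    obtain ⟨k, hk⟩ : ∃ k, n.unpair.2 = k := ⟨_, rfl⟩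
    simp only [hi, hk]
    rw [matMul_eq_sum_col a i k (s k) fun j hj => (hmem j k).2 hj]
    refine (hG'.toIsDisk.diskNorm_sum_le _ _ fun j => hab i j k).trans ?_
    have step : ∀ j ∈ s k, diskNorm G (a i j * b j k) ≤ C * diskNorm D (a i j) := by
      intro j _
      refine (diskNorm_mul_le hD'.toIsDisk hE'.toIsDisk hsub (haD' i j) (hbE' j k)).trans ?_
      rw [mul_comm]
      exact mul_le_mul_of_nonneg_right (hC' j k) (diskNorm_nonneg _ _)
    refine (Finset.sum_le_sum step).trans ?_
    rw [← Finset.mul_sum]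
    refine mul_le_mul_of_nonneg_left ?_ hC0
    let T := (Finset.range N).filter fun t => n ∈ B t
    have hT : s k ⊆ T.image (e k) := by
      intro j hj
      obtain ⟨t, ht, htj⟩ := he k j hj
      refine Finset.mem_image.2 ⟨t, ?_, htj⟩
      simp only [T, Finset.mem_filter, Finset.mem_range]
      refine ⟨ht, ?_⟩
      change b (e n.unpair.2 t) n.unpair.2 ≠ 0
      rw [hk, htj]
      exact (hmem j k).1 hj
    calc ∑ j ∈ s k, diskNorm D (a i j) ≤ ∑ j ∈ T.image (e k), diskNorm D (a i j) :=
          Finset.sum_le_sum_of_subset_of_nonneg hT fun _ _ _ => diskNorm_nonneg _ _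
      _ ≤ ∑ t ∈ T, diskNorm D (a i (e k t)) :=
          Finset.sum_image_le_of_nonneg fun _ _ => diskNorm_nonneg _ _
      _ = _ := by rw [Finset.sum_filter]

theorem MemI.map {B : Type*} [NonUnitalRing B] [Module ℂ B] [Bornology B]
    [BornologicalAlgebra B] (f : A →ₙₐ[ℂ] B)
    (hf : ∀ s : Set A, IsBounded s → IsBounded (f '' s)) {a : ℕ → ℕ → A} (ha : MemI S a) :
    MemI S (fun i j => f (a i j)) := by
  obtain ⟨ha, D, hD, hD', haD, haS⟩ := ha
  obtain ⟨G, hG, hG', hsub⟩ := exists_bounded_disk (f '' D) (hf D hD)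
  let g : A →ₗ[ℂ] B := { toFun := f, map_add' := map_add f, map_smul' := map_smul f }
  have hg : ∀ x ∈ D, g x ∈ G := fun x hx => hsub ⟨x, hx, rfl⟩
  refine ⟨ha.of_zero fun i j h => by simp [h], G, hG, hG',
    fun n => map_mem_diskSpan g hg (haD n), ?_⟩
  refine S.mem_of_norm_le haS fun n => ?_
  rw [Complex.norm_real, Complex.norm_real, Real.norm_of_nonneg (diskNorm_nonneg _ _),
    Real.norm_of_nonneg (diskNorm_nonneg _ _)]
  exact hD'.toIsDisk.diskNorm_map_le g hg (haD n)

variable (S A)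

/-- The underlying vector space of `I_{S(A)}`. -/
def ISubmodule : Submodule ℂ (ℕ → ℕ → A) where
  carrier := {a | MemI S a}
  zero_mem' := MemI.zero S
  add_mem' := MemI.add
  smul_mem' c _ h := MemI.smul c h

/-- The algebra `I_{S(A)}` of `ℕ × ℕ`-matrices, with the entrywise vector space structure and
matrix multiplication. -/
def IAlg : Type _ := ISubmodule S A

variable {S A}

instance : AddCommGroup (IAlg S A) := inferInstanceAs (AddCommGroup (ISubmodule S A))

instance : Module ℂ (IAlg S A) := inferInstanceAs (Module ℂ (ISubmodule S A))

/-- The matrix of an element of `I_{S(A)}`. -/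
def IAlg.entries (a : IAlg S A) : ℕ → ℕ → A := a.1

theorem IAlg.memI (a : IAlg S A) : MemI S a.entries := a.2

/-- The element of `I_{S(A)}` with a given matrix. -/
def IAlg.mk (a : ℕ → ℕ → A) (h : MemI S a) : IAlg S A := ⟨a, h⟩

theorem IAlg.ext {a b : IAlg S A} (h : ∀ i j, a.entries i j = b.entries i j) : a = b :=
  Subtype.ext (funext fun i => funext fun j => h i j)

instance : Mul (IAlg S A) := ⟨fun a b => IAlg.mk (matMul a.entries b.entries) (a.memI.mul b.memI)⟩

theorem IAlg.entries_mul (a b : IAlg S A) : (a * b).entries = matMul a.entries b.entries := rfl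

theorem IAlg.entries_add (a b : IAlg S A) (i j : ℕ) :
    (a + b).entries i j = a.entries i j + b.entries i j := rfl

theorem IAlg.entries_smul (c : ℂ) (a : IAlg S A) (i j : ℕ) :
    (c • a).entries i j = c • a.entries i j := rfl

theorem IAlg.entries_zero (i j : ℕ) : (0 : IAlg S A).entries i j = 0 := rfl

theorem IAlg.entries_mul_row (a b : IAlg S A) (i k : ℕ) :
    (a * b).entries i k =
      ∑ j ∈ (a.memI.1.row_finite i).toFinset, a.entries i j * b.entries j k :=
  matMul_eq_sum_row _ _ _ _ fun j hj => by simpa using hj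

theorem IAlg.entries_mul_col (a b : IAlg S A) (i k : ℕ) :
    (a * b).entries i k =
      ∑ j ∈ (b.memI.1.col_finite k).toFinset, a.entries i j * b.entries j k :=
  matMul_eq_sum_col _ _ _ _ fun j hj => by simpa using hj

instance : NonUnitalRing (IAlg S A) :=
  { (inferInstance : AddCommGroup (IAlg S A)), (inferInstance : Mul (IAlg S A)) with
    left_distrib := fun a b c => IAlg.ext fun i k => by
      rw [IAlg.entries_add, IAlg.entries_mul_row a b, IAlg.entries_mul_row a c,
        IAlg.entries_mul_row a (b + c), ← Finset.sum_add_distrib]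
      exact Finset.sum_congr rfl fun j _ => by rw [IAlg.entries_add, mul_add]
    right_distrib := fun a b c => IAlg.ext fun i k => by
      rw [IAlg.entries_add, IAlg.entries_mul_col a c, IAlg.entries_mul_col b c,
        IAlg.entries_mul_col (a + b) c, ← Finset.sum_add_distrib]
      exact Finset.sum_congr rfl fun j _ => by rw [IAlg.entries_add, add_mul]
    zero_mul := fun a => IAlg.ext fun i k => by
      rw [IAlg.entries_mul_col]
      simp [IAlg.entries_zero]
    mul_zero := fun a => IAlg.ext fun i k => by
      rw [IAlg.entries_mul_row]
      simp [IAlg.entries_zero]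
    mul_assoc := fun a b c => Subtype.ext (matMul_assoc a.memI.1 c.memI.1) }

instance : IsScalarTower ℂ (IAlg S A) (IAlg S A) where
  smul_assoc c a b := IAlg.ext fun i k => by
    simp only [smul_eq_mul]
    rw [IAlg.entries_smul, IAlg.entries_mul_col, IAlg.entries_mul_col, Finset.smul_sum]
    exact Finset.sum_congr rfl fun j _ => by rw [IAlg.entries_smul, smul_mul_assoc]

instance : SMulCommClass ℂ (IAlg S A) (IAlg S A) where
  smul_comm c a b := IAlg.ext fun i k => by
    simp only [smul_eq_mul]
    rw [IAlg.entries_smul, IAlg.entries_mul_row, IAlg.entries_mul_row, Finset.smul_sum]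
    exact Finset.sum_congr rfl fun j _ => by rw [IAlg.entries_smul, mul_smul_comm]

/-- The homomorphism `I_{S(A)} → I_{S(B)}` given by applying a bounded homomorphism `A → B` to
the entries. -/
def IAlg.map {B : Type*} [NonUnitalRing B] [Module ℂ B] [Bornology B]
    [BornologicalAlgebra B] (f : A →ₙₐ[ℂ] B)
    (hf : ∀ s : Set A, IsBounded s → IsBounded (f '' s)) : IAlg S A →ₙₐ[ℂ] IAlg S B where
  toFun a := IAlg.mk (fun i j => f (a.entries i j)) (a.memI.map f hf)
  map_smul' c a := IAlg.ext fun i j => map_smul f c (a.entries i j)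
  map_zero' := IAlg.ext fun _ _ => map_zero f
  map_add' a b := IAlg.ext fun i j => map_add f (a.entries i j) (b.entries i j)
  map_mul' a b := IAlg.ext fun i k => by
    change f ((a * b).entries i k) = matMul _ _ i k
    rw [IAlg.entries_mul_row, map_sum]
    refine (Eq.trans (matMul_eq_sum_row (a := fun i j => f (a.entries i j))
      (fun i j => f (b.entries i j)) i k (a.memI.1.row_finite i).toFinset ?_) ?_).symm
    · intro j hj
      simp only [Set.Finite.mem_toFinset, Set.mem_ofPred_eq]
      rintro h0
      exact hj (by simp [h0])
    · exact Finset.sum_congr rfl fun j _ => (map_mul f _ _).symm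

end ISA

/-- The functor `A ↦ I_{S(A)}` from bornological algebras to algebras. -/
def I (S : SymmIdeal) : BornAlg.{u} ⥤ Alg.{u} where
  obj A := Alg.mk (IAlg S A.carrier)
  map f := Alg.ofHom (IAlg.map f.toHom f.isBounded_image)
  map_id _ := rfl
  map_comp _ _ := rfl

/-! ### Split-exact and `M₂`-stable functors -/

/-- `F` is split-exact: it sends every short exact sequence `0 → A → B → C → 0` of algebras
which is split by an algebra homomorphism `C → B` to a short exact sequence
`0 → F(A) → F(B) → F(C) → 0` of abelian groups. -/
def SplitExact (F : Alg.{u} ⥤ AddCommGrpCat.{v}) : Prop :=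
  ∀ (A B C : Alg.{u}) (i : A ⟶ B) (q : B ⟶ C) (s : C ⟶ B),
    Function.Injective (Alg.toHom i) →
    (∀ b, Alg.toHom q b = 0 ↔ b ∈ Set.range (Alg.toHom i)) →
    s ≫ q = 𝟙 C →
    Function.Injective (F.map i).hom ∧
      (∀ y, (F.map q).hom y = 0 ↔ y ∈ Set.range (F.map i).hom) ∧
      Function.Surjective (F.map q).hom

/-- The upper left corner inclusion `A → M₂(A)`. -/
def corner (A : Type*) [NonUnitalRing A] [Module ℂ A] [IsScalarTower ℂ A A]
    [SMulCommClass ℂ A A] : A →ₙₐ[ℂ] Matrix (Fin 2) (Fin 2) A where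
  toFun a := !![a, 0; 0, 0]
  map_smul' c a := by ext i j; fin_cases i <;> fin_cases j <;> simp
  map_zero' := by ext i j; fin_cases i <;> fin_cases j <;> simp
  map_add' a b := by ext i j; fin_cases i <;> fin_cases j <;> simp
  map_mul' a b := by
    ext i j; fin_cases i <;> fin_cases j <;> simp [Matrix.mul_apply, Fin.sum_univ_two]

/-- `F` is `M₂`-stable: it sends the corner inclusion `A → M₂(A)` to an isomorphism for every
algebra `A`. -/
def M2Stable (F : Alg.{u} ⥤ AddCommGrpCat.{v}) : Prop :=
  ∀ A : Alg.{u}, IsIso (F.map (Alg.ofHom (corner A.carrier)))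

/-! ### Homotopies -/

section FunctionSpaces

variable {V : Type*} [AddCommGroup V] [Module ℂ V] [Bornology V]

/-- Bounded subsets of `C(T, V)`: there is a bounded complete disk `D` such that all functions
in the set are continuous functions into the Banach space `V_D`, with uniformly bounded norms.
A function is an element of `C(T, V)` if and only if its singleton is such a set. -/
def IsBoundedInC {T : Type*} [TopologicalSpace T] (Φ : Set (T → V)) : Prop :=
  ∃ D : Set V, IsBounded D ∧ IsBanachDisk D ∧
    (∀ f ∈ Φ, (∀ t, f t ∈ diskSpan D) ∧
      ∀ t, Tendsto (fun s => diskNorm D (f s - f t)) (𝓝 t) (𝓝 0)) ∧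
    ∃ C : ℝ, ∀ f ∈ Φ, ∀ t, diskNorm D (f t) ≤ C

/-- Bounded subsets of `H^r(X, V)`: there is a bounded complete disk `D` such that all functions
in the set are `r`-Hölder continuous functions into the Banach space `V_D`, with uniformly
bounded norms and Hölder constants. A function is an element of `H^r(X, V)` if and
only if its singleton is such a set (when `X` is bounded). -/
def IsBoundedInH {X : Type*} [MetricSpace X] (r : ℝ) (Φ : Set (X → V)) : Prop :=
  ∃ D : Set V, IsBounded D ∧ IsBanachDisk D ∧
    (∀ f ∈ Φ, ∀ t, f t ∈ diskSpan D) ∧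
    ∃ C : ℝ, ∀ f ∈ Φ, (∀ t, diskNorm D (f t) ≤ C) ∧
      ∀ s t, diskNorm D (f s - f t) ≤ C * dist s t ^ r

end FunctionSpaces

/-- There is a continuous homotopy from `f₀` to `f₁`: a bounded homomorphism
`H : A → C([0,1], B)` with `ev_i ∘ H = f_i` for `i = 0, 1`. -/
def ContinuouslyHomotopic {A B : BornAlg.{u}} (f₀ f₁ : A ⟶ B) : Prop :=
  ∃ H : A.carrier →ₙₐ[ℂ] (unitInterval → B.carrier),
    (∀ s : Set A.carrier, IsBounded s → IsBoundedInC (H '' s)) ∧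
    ∀ a, H a 0 = f₀.toHom a ∧ H a 1 = f₁.toHom a

/-- There is an `r`-Hölder continuous homotopy from `f₀` to `f₁`: a bounded homomorphism
`H : A → H^r([0,1], B)` with `ev_i ∘ H = f_i` for `i = 0, 1`. -/
def HolderHomotopic (r : ℝ) {A B : BornAlg.{u}} (f₀ f₁ : A ⟶ B) : Prop :=
  ∃ H : A.carrier →ₙₐ[ℂ] (unitInterval → B.carrier),
    (∀ s : Set A.carrier, IsBounded s → IsBoundedInH r (H '' s)) ∧
    ∀ a, H a 0 = f₀.toHom a ∧ H a 1 = f₁.toHom a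

/-- A functor on bornological algebras is invariant under continuous homotopies if it maps
continuously homotopic homomorphisms to equal maps. -/
def InvariantUnderContinuousHomotopies (G : BornAlg.{u} ⥤ AddCommGrpCat.{v}) : Prop :=
  ∀ (A B : BornAlg.{u}) (f₀ f₁ : A ⟶ B), ContinuouslyHomotopic f₀ f₁ → G.map f₀ = G.map f₁

/-- A functor on bornological algebras is invariant under `r`-Hölder homotopies if it maps
`r`-Hölder homotopic homomorphisms to equal maps. -/
def InvariantUnderHolderHomotopies (r : ℝ) (G : BornAlg.{u} ⥤ AddCommGrpCat.{v}) : Prop :=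
  ∀ (A B : BornAlg.{u}) (f₀ f₁ : A ⟶ B), HolderHomotopic r f₀ f₁ → G.map f₀ = G.map f₁

end

end BornK

/-! Let `H` be a homotopy from `f₀` to `f₁`. The dyadic subintervals of [0,1] are numbered by the
nodes of a binary tree. Three block diagonal homomorphisms φL, φM, φR go from I_S(A) to the algebra
of bounded matrices over B. Their k-th blocks are `H` evaluated at the left end, the midpoint and
the right end of the k-th interval.

Cutting the tree at its root gives, up to reindexing, φL = f₀ ⊕ φL ⊕ φM and φR = f₁ ⊕ φM ⊕ φR: the
left half of an interval runs from its left end to its midpoint, the right half from its midpoint to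
its right end (`IAlg.block_eq_sum`). The intervals shrink, so φL, φM, φR differ by maps into the
ideal I_S(B) (`IAlg.exists_incl_eq_block_sub`). A pair of homomorphisms that agree modulo an ideal
induces, under a split-exact functor, a map [φ, ψ] into the value of `F` on that ideal. Moving
blocks along an injection of ℕ acts trivially by M₂-stability (`M2Stable.induced_spreadHom`), so
block sums become sums: [φL, φR] = F(f₀) − F(f₁) + [φL, φM] + [φM, φR] = F(f₀) − F(f₁) + [φL, φR].
Hence F(f₀) = F(f₁). This Eilenberg swindle is `induced_eq_of_swindle`.

Analysis enters only in showing that the differences lie in I_S(B). The k-th interval has length at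
most 2/(k+2). Uniform continuity is enough for c₀. In the Hölder case the k-th difference is
O((k+2)^(−λ)), which is p-summable because λp > 1. -/

namespace BornK

/-! ### Formal consequences of split-exactness and M₂-stability. -/

section Functor

variable (F : Alg.{u} ⥤ AddCommGrpCat.{v})
variable {A B C : Type u}
  [NonUnitalRing A] [Module ℂ A] [IsScalarTower ℂ A A] [SMulCommClass ℂ A A]
  [NonUnitalRing B] [Module ℂ B] [IsScalarTower ℂ B B] [SMulCommClass ℂ B B]
  [NonUnitalRing C] [Module ℂ C] [IsScalarTower ℂ C C] [SMulCommClass ℂ C C]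

/-- The group homomorphism induced by an algebra homomorphism. -/
def induced (f : A →ₙₐ[ℂ] B) : F.obj (Alg.mk A) →+ F.obj (Alg.mk B) :=
  (F.map (Alg.ofHom f)).hom

theorem induced_comp (g : B →ₙₐ[ℂ] C) (f : A →ₙₐ[ℂ] B) (x : F.obj (Alg.mk A)) :
    induced F (g.comp f) x = induced F g (induced F f x) := by
  have : Alg.ofHom (g.comp f) = Alg.ofHom f ≫ Alg.ofHom g := rfl
  simp [induced, this]

theorem induced_id (x : F.obj (Alg.mk A)) : induced F (NonUnitalAlgHom.id ℂ A) x = x := by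
  have : Alg.ofHom (NonUnitalAlgHom.id ℂ A) = 𝟙 (Alg.mk A) := rfl
  simp [induced, this]

variable {F}

theorem SplitExact.induced (hF : SplitExact F) (i : A →ₙₐ[ℂ] B) (q : B →ₙₐ[ℂ] C)
    (s : C →ₙₐ[ℂ] B) (hi : Function.Injective i) (hq : ∀ b, q b = 0 ↔ b ∈ Set.range i)
    (hs : ∀ c, q (s c) = c) :
    Function.Injective (induced F i) ∧
      ∀ y, BornK.induced F q y = 0 ↔ y ∈ Set.range (BornK.induced F i) := by
  have h := hF (Alg.mk A) (Alg.mk B) (Alg.mk C) (Alg.ofHom i) (Alg.ofHom q) (Alg.ofHom s) hi hq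
    (NonUnitalAlgHom.ext hs)
  exact ⟨h.1, h.2.1⟩

/-- The zero homomorphism factors through the zero algebra, and `F` vanishes there: with all three
maps the identity, 0 → 0 → 0 is a split extension, so the identity of its `F`-group is zero. -/
theorem SplitExact.induced_zero (hF : SplitExact F) (x : F.obj (Alg.mk A)) :
    BornK.induced F (0 : A →ₙₐ[ℂ] B) x = 0 := by
  have hP : ∀ y : F.obj (Alg.mk PUnit.{u + 1}), y = 0 := by
    intro y
    have h := hF.induced (NonUnitalAlgHom.id ℂ PUnit.{u + 1}) (NonUnitalAlgHom.id ℂ PUnit.{u + 1})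
      (NonUnitalAlgHom.id ℂ PUnit.{u + 1}) Function.injective_id
      (fun b => ⟨fun _ => ⟨b, rfl⟩, fun _ => rfl⟩) (fun _ => rfl)
    have h' := (h.2 y).2 ⟨y, induced_id F y⟩
    rwa [induced_id] at h'
  have hc : (0 : A →ₙₐ[ℂ] B) = (0 : PUnit.{u + 1} →ₙₐ[ℂ] B).comp (0 : A →ₙₐ[ℂ] PUnit.{u + 1}) :=
    rfl
  rw [hc, induced_comp, hP (BornK.induced F _ x), map_zero]

/-- The extension B → A × B → A is split by `inl`. After subtracting the `inl` part, `y` lies in the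
kernel of `fst`, hence comes from B; applying `snd` identifies that element. -/
theorem SplitExact.prod_decomp (hF : SplitExact F) (y : F.obj (Alg.mk (A × B))) :
    y = BornK.induced F (NonUnitalAlgHom.inl ℂ A B) (BornK.induced F (NonUnitalAlgHom.fst ℂ A B) y) +
      BornK.induced F (NonUnitalAlgHom.inr ℂ A B)
        (BornK.induced F (NonUnitalAlgHom.snd ℂ A B) y) := by
  have h := hF.induced (NonUnitalAlgHom.inr ℂ A B) (NonUnitalAlgHom.fst ℂ A B)
    (NonUnitalAlgHom.inl ℂ A B) (fun x y h => congrArg Prod.snd h)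
    (fun b => ⟨fun hb => ⟨b.2, Prod.ext hb.symm rfl⟩, by rintro ⟨x, rfl⟩; rfl⟩) (fun _ => rfl)
  have h1 : (NonUnitalAlgHom.fst ℂ A B).comp (NonUnitalAlgHom.inl ℂ A B) =
      NonUnitalAlgHom.id ℂ A := rfl
  have h2 : (NonUnitalAlgHom.snd ℂ A B).comp (NonUnitalAlgHom.inl ℂ A B) = 0 := rfl
  have h3 : (NonUnitalAlgHom.snd ℂ A B).comp (NonUnitalAlgHom.inr ℂ A B) =
      NonUnitalAlgHom.id ℂ B := rfl
  obtain ⟨z, hz⟩ := (h.2 (y - BornK.induced F (NonUnitalAlgHom.inl ℂ A B)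
    (BornK.induced F (NonUnitalAlgHom.fst ℂ A B) y))).1 (by
      rw [map_sub, ← induced_comp, h1, induced_id, sub_self])
  have hz' := congrArg (BornK.induced F (NonUnitalAlgHom.snd ℂ A B)) hz
  rw [← induced_comp, h3, induced_id, map_sub, ← induced_comp F _ (NonUnitalAlgHom.inl ℂ A B), h2,
    hF.induced_zero, sub_zero] at hz'
  rw [← hz', hz]
  abel

/-- This is how `F` of a homomorphism enters additively: in the swindle the two graphs of `h₀` and
`h₁` differ by exactly the image of F(h₀) − F(h₁). -/
theorem SplitExact.induced_graph (hF : SplitExact F) (h : A →ₙₐ[ℂ] B) (x : F.obj (Alg.mk A)) :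
    BornK.induced F ((NonUnitalAlgHom.id ℂ A).prod h) x =
      BornK.induced F (NonUnitalAlgHom.inl ℂ A B) x +
        BornK.induced F (NonUnitalAlgHom.inr ℂ A B) (BornK.induced F h x) := by
  have h1 : (NonUnitalAlgHom.fst ℂ A B).comp ((NonUnitalAlgHom.id ℂ A).prod h) =
      NonUnitalAlgHom.id ℂ A := rfl
  have h2 : (NonUnitalAlgHom.snd ℂ A B).comp ((NonUnitalAlgHom.id ℂ A).prod h) = h := rfl
  rw [hF.prod_decomp (BornK.induced F ((NonUnitalAlgHom.id ℂ A).prod h) x), ← induced_comp F _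
    ((NonUnitalAlgHom.id ℂ A).prod h), h1, induced_id, ← induced_comp F _
    ((NonUnitalAlgHom.id ℂ A).prod h), h2]

/-- The lower right corner inclusion `A → M₂(A)`. -/
def lowerCorner (A : Type*) [NonUnitalRing A] [Module ℂ A] [IsScalarTower ℂ A A]
    [SMulCommClass ℂ A A] : A →ₙₐ[ℂ] Matrix (Fin 2) (Fin 2) A where
  toFun a := !![0, 0; 0, a]
  map_smul' c a := by ext i j; fin_cases i <;> fin_cases j <;> simp
  map_zero' := by ext i j; fin_cases i <;> fin_cases j <;> simp
  map_add' a b := by ext i j; fin_cases i <;> fin_cases j <;> simp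
  map_mul' a b := by
    ext i j; fin_cases i <;> fin_cases j <;> simp [Matrix.mul_apply, Fin.sum_univ_two]

/-- The automorphism of `M₂(A)` that exchanges the two coordinates. -/
def matrixSwap (A : Type*) [NonUnitalRing A] [Module ℂ A] [IsScalarTower ℂ A A]
    [SMulCommClass ℂ A A] : Matrix (Fin 2) (Fin 2) A →ₙₐ[ℂ] Matrix (Fin 2) (Fin 2) A where
  toFun a := !![a 1 1, a 1 0; a 0 1, a 0 0]
  map_smul' c a := by ext i j; fin_cases i <;> fin_cases j <;> simp
  map_zero' := by ext i j; fin_cases i <;> fin_cases j <;> simp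
  map_add' a b := by ext i j; fin_cases i <;> fin_cases j <;> simp
  map_mul' a b := by
    ext i j; fin_cases i <;> fin_cases j <;>
      simp [Matrix.mul_apply, Fin.sum_univ_two, add_comm]

theorem M2Stable.bijective_corner (hF : M2Stable F) :
    Function.Bijective (induced F (corner A)) := by
  have := hF (Alg.mk A)
  exact ConcreteCategory.bijective_of_isIso (F.map (Alg.ofHom (corner A)))

theorem M2Stable.bijective_lowerCorner (hF : M2Stable F) :
    Function.Bijective (induced F (lowerCorner A)) := by
  have h1 : lowerCorner A = (matrixSwap A).comp (corner A) := by
    ext a i j; fin_cases i <;> fin_cases j <;> simp [lowerCorner, matrixSwap, corner]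
  have h2 : (matrixSwap A).comp (matrixSwap A) = NonUnitalAlgHom.id ℂ _ := by
    ext a i j; fin_cases i <;> fin_cases j <;> simp [matrixSwap]
  have h3 : Function.Involutive (induced F (matrixSwap A)) := fun x => by
    rw [← induced_comp, h2, induced_id]
  have h4 : ⇑(induced F (lowerCorner A)) = induced F (matrixSwap A) ∘ induced F (corner A) := by
    funext x
    rw [h1, induced_comp]; rfl
  rw [h4]
  exact h3.bijective.comp hF.bijective_corner

/-- An endomorphism of the form `x ↦ v x w` with `w v = 1` acts trivially. The maps `T i j` are
`x ↦ vᵢ x wⱼ` with `v₀ = v`, `w₀ = w`, `v₁ = w₁ = 1`. -/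
theorem M2Stable.induced_eq_self (hF : M2Stable F) (T : Fin 2 → Fin 2 → A →ₗ[ℂ] A)
    (hmul : ∀ i j k x y, T i j x * T j k y = T i k (x * y)) (h11 : ∀ x, T 1 1 x = x)
    (f : A →ₙₐ[ℂ] A) (hf : ∀ x, f x = T 0 0 x) (x : F.obj (Alg.mk A)) : induced F f x = x := by
  -- This is a ↦ diag(v, 1) · a · diag(w, 1). It fixes the lower corner, so F(β) is the identity by
  -- stability; on the upper corner it is `f`.
  let β : Matrix (Fin 2) (Fin 2) A →ₙₐ[ℂ] Matrix (Fin 2) (Fin 2) A :=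
    { toFun := fun a => Matrix.of fun i j => T i j (a i j)
      map_smul' := fun c a => by ext i j; simp
      map_zero' := by ext i j; simp
      map_add' := fun a b => by ext i j; simp
      map_mul' := fun a b => by ext i j; simp [Matrix.mul_apply, hmul] }
  have h1 : β.comp (lowerCorner A) = lowerCorner A := by
    ext a i j; fin_cases i <;> fin_cases j <;> simp [lowerCorner, β, h11]
  have h2 : β.comp (corner A) = (corner A).comp f := by
    ext a i j; fin_cases i <;> fin_cases j <;> simp [corner, β, hf]
  have h3 : ∀ y, induced F β y = y := fun y => by
    obtain ⟨z, rfl⟩ := (hF.bijective_lowerCorner (A := A)).2 y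
    rw [← induced_comp, h1]
  apply (hF.bijective_corner (A := A)).1
  rw [← induced_comp, ← h2, induced_comp, h3]

end Functor

/-! ### The Eilenberg swindle for split-exact functors. -/

section Swindle

variable {F : Alg.{u} ⥤ AddCommGrpCat.{v}}
variable {A G J : Type u}
  [NonUnitalRing A] [Module ℂ A] [IsScalarTower ℂ A A] [SMulCommClass ℂ A A]
  [NonUnitalRing G] [Module ℂ G] [IsScalarTower ℂ G G] [SMulCommClass ℂ G G]
  [NonUnitalRing J] [Module ℂ J] [IsScalarTower ℂ J J] [SMulCommClass ℂ J J]

/-- The extension of `A` by an ideal `J` of `G` that is defined by `φ : A → G`. -/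
def extensionAlg (ι : J →ₙₐ[ℂ] G) (hl : ∀ g x, ∃ y, ι y = g * ι x)
    (hr : ∀ g x, ∃ y, ι y = ι x * g) (φ : A →ₙₐ[ℂ] G) : NonUnitalSubalgebra ℂ (A × G) where
  carrier := {p | ∃ y, ι y = p.2 - φ p.1}
  zero_mem' := ⟨0, by simp⟩
  add_mem' := by
    rintro p p' ⟨y, hy⟩ ⟨y', hy'⟩
    exact ⟨y + y', by rw [map_add, hy, hy']; simp; abel⟩
  smul_mem' := by
    rintro c p ⟨y, hy⟩
    exact ⟨c • y, by rw [map_smul, hy, smul_sub]; simp⟩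
  mul_mem' := by
    rintro p p' ⟨y, hy⟩ ⟨y', hy'⟩
    -- Uses g g' − φ(a)φ(a') = g (g' − φ(a')) + (g − φ(a)) φ(a').
    obtain ⟨z, hz⟩ := hl p.2 y'
    obtain ⟨z', hz'⟩ := hr (φ p'.1) y
    refine ⟨z + z', ?_⟩
    rw [map_add, hz, hz', hy, hy', Prod.fst_mul, Prod.snd_mul, map_mul]
    noncomm_ring

/-- The homomorphism into `extensionAlg` with given components. -/
def extensionLift {X : Type*} [NonUnitalRing X] [Module ℂ X] {ι : J →ₙₐ[ℂ] G}
    {hl : ∀ g x, ∃ y, ι y = g * ι x} {hr : ∀ g x, ∃ y, ι y = ι x * g} {φ : A →ₙₐ[ℂ] G}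
    (f : X →ₙₐ[ℂ] A) (g : X →ₙₐ[ℂ] G) (h : ∀ x, ∃ y, ι y = g x - φ (f x)) :
    X →ₙₐ[ℂ] extensionAlg ι hl hr φ :=
  NonUnitalAlgHom.codRestrict (f.prod g) _ h

/-- The block sum of three homomorphisms along three endomorphisms with orthogonal ranges. -/
def blockSum {X : Type*} [NonUnitalRing X] [Module ℂ X] (c : Fin 3 → G →ₙₐ[ℂ] G)
    (h : ∀ i j, i ≠ j → ∀ x y, c i x * c j y = 0) (f : Fin 3 → X →ₙₐ[ℂ] G) : X →ₙₐ[ℂ] G where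
  toFun x := ∑ i, c i (f i x)
  map_smul' r x := by simp [Finset.smul_sum]
  map_zero' := by simp
  map_add' x y := by simp [Finset.sum_add_distrib]
  map_mul' x y := by
    rw [Finset.sum_mul_sum]
    refine Finset.sum_congr rfl fun i _ => ?_
    rw [map_mul, map_mul, Finset.sum_eq_single i (fun j _ hj => h i j hj.symm _ _) (by simp)]

theorem blockSum_apply {X : Type*} [NonUnitalRing X] [Module ℂ X] (c : Fin 3 → G →ₙₐ[ℂ] G)
    (h : ∀ i j, i ≠ j → ∀ x y, c i x * c j y = 0) (f₀ f₁ f₂ : X →ₙₐ[ℂ] G) (x : X) :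
    blockSum c h ![f₀, f₁, f₂] x = c 0 (f₀ x) + c 1 (f₁ x) + c 2 (f₂ x) :=
  Fin.sum_univ_three fun i => c i (![f₀, f₁, f₂] i x)

/-- All comparisons are made in the split extension `E` of A by J, where F(J) injects into F(E) and
the homomorphisms φL, φM, φR become sections `sL`, `sM`, `sR`. The passage from h₀ ⊕ φL ⊕ φM = φL to
h₁ ⊕ φM ⊕ φR = φR goes in three moves, each changing a single block: h₀ to h₁ in block 0, φL to φM
in block 1, φM to φR in block 2. Each move is the image of a difference of sections under an
endomorphism-like map that acts on J as `cJ i`, hence trivially after `F`. -/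
theorem induced_eq_of_swindle (hF : SplitExact F) (ι : J →ₙₐ[ℂ] G) (hι : Function.Injective ι)
    (hl : ∀ g x, ∃ y, ι y = g * ι x) (hr : ∀ g x, ∃ y, ι y = ι x * g)
    (cG : Fin 3 → G →ₙₐ[ℂ] G) (cJ : Fin 3 → J →ₙₐ[ℂ] J) (hc : ∀ i x, ι (cJ i x) = cG i (ι x))
    (horth : ∀ i j, i ≠ j → ∀ x y, cG i x * cG j y = 0)
    (hcF : ∀ i x, induced F (cJ i) x = x)
    (h₀ h₁ : A →ₙₐ[ℂ] J) (φL φM φR : A →ₙₐ[ℂ] G)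
    (hM : ∀ a, ∃ y, ι y = φM a - φL a) (hR : ∀ a, ∃ y, ι y = φR a - φL a)
    (hLdec : ∀ a, φL a = cG 0 (ι (h₀ a)) + cG 1 (φL a) + cG 2 (φM a))
    (hRdec : ∀ a, φR a = cG 0 (ι (h₁ a)) + cG 1 (φM a) + cG 2 (φR a)) (x : F.obj (Alg.mk A)) :
    induced F h₀ x = induced F h₁ x := by
  let E := extensionAlg ι hl hr φL
  let p : E →ₙₐ[ℂ] A := (NonUnitalAlgHom.fst ℂ A G).comp (NonUnitalSubalgebraClass.subtype E)
  let q : E →ₙₐ[ℂ] G := (NonUnitalAlgHom.snd ℂ A G).comp (NonUnitalSubalgebraClass.subtype E)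
  have hpq : ∀ e : E, ∃ y, ι y = q e - φL (p e) := fun e => e.2
  let k : J →ₙₐ[ℂ] E := extensionLift 0 ι fun y => ⟨y, by simp⟩
  let idA := NonUnitalAlgHom.id ℂ A
  let sL : A →ₙₐ[ℂ] E := extensionLift idA φL fun a => ⟨0, by simp [idA]⟩
  let sM : A →ₙₐ[ℂ] E := extensionLift idA φM hM
  let sR : A →ₙₐ[ℂ] E := extensionLift idA φR hR
  -- With blocks written in the order 0, 1, 2, the map `τ₀` sends (a, y) to y ⊕ φL(a) ⊕ φM(a), while
  -- `τ₁` and `τ₂` send (a, g) to h₁(a) ⊕ g ⊕ φM(a) and h₁(a) ⊕ φM(a) ⊕ g. Each leaves one block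
  -- variable.
  let τ₀ : A × J →ₙₐ[ℂ] E := extensionLift (NonUnitalAlgHom.fst ℂ A J)
    (blockSum cG horth ![ι.comp (NonUnitalAlgHom.snd ℂ A J),
      φL.comp (NonUnitalAlgHom.fst ℂ A J), φM.comp (NonUnitalAlgHom.fst ℂ A J)]) (by
      rintro ⟨a, y⟩
      -- By `hLdec`, the values differ from φL(a) = h₀(a) ⊕ φL(a) ⊕ φM(a) in block 0 only.
      refine ⟨cJ 0 (y - h₀ a), ?_⟩
      rw [hc, map_sub, map_sub, blockSum_apply]
      change _ = cG 0 (ι y) + cG 1 (φL a) + cG 2 (φM a) - φL a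
      conv_rhs => enter [2]; rw [hLdec a]
      abel)
  let τ₁ : E →ₙₐ[ℂ] E := extensionLift p
    (blockSum cG horth ![(ι.comp h₁).comp p, q, φM.comp p]) (by
      intro e
      obtain ⟨y, hy⟩ := hpq e
      refine ⟨cJ 0 (h₁ (p e) - h₀ (p e)) + cJ 1 y, ?_⟩
      rw [map_add, hc, hc, hy, map_sub, map_sub, map_sub, blockSum_apply]
      change _ = cG 0 (ι (h₁ (p e))) + cG 1 (q e) + cG 2 (φM (p e)) - φL (p e)
      conv_rhs => enter [2]; rw [hLdec (p e)]
      abel)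
  let τ₂ : E →ₙₐ[ℂ] E := extensionLift p
    (blockSum cG horth ![(ι.comp h₁).comp p, φM.comp p, q]) (by
      intro e
      obtain ⟨y, hy⟩ := hpq e
      -- Block by block, the difference from φL is h₁ − h₀, φM − φL and g − φM; the last is (g − φL)
      -- − (φM − φL), whence `y - m`.
      obtain ⟨m, hm⟩ := hM (p e)
      refine ⟨cJ 0 (h₁ (p e) - h₀ (p e)) + cJ 1 m + cJ 2 (y - m), ?_⟩
      rw [map_add, map_add, hc, hc, hc, map_sub ι, map_sub ι, hm, hy, blockSum_apply]
      change _ = cG 0 (ι (h₁ (p e))) + cG 1 (φM (p e)) + cG 2 (q e) - φL (p e)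
      conv_rhs => enter [2]; rw [hLdec (p e)]
      simp only [map_sub]
      abel)
  have qτ₀ : ∀ w, q (τ₀ w) = cG 0 (ι w.2) + cG 1 (φL w.1) + cG 2 (φM w.1) :=
    blockSum_apply cG horth _ _ _
  have qτ₁ : ∀ e, q (τ₁ e) = cG 0 (ι (h₁ (p e))) + cG 1 (q e) + cG 2 (φM (p e)) :=
    blockSum_apply cG horth _ _ _
  have qτ₂ : ∀ e, q (τ₂ e) = cG 0 (ι (h₁ (p e))) + cG 1 (φM (p e)) + cG 2 (q e) :=
    blockSum_apply cG horth _ _ _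
  have ext_iff : ∀ {X : Type u} [NonUnitalRing X] [Module ℂ X] (f g : X →ₙₐ[ℂ] E),
      (∀ x, p (f x) = p (g x)) → (∀ x, q (f x) = q (g x)) → f = g := fun f g h h' =>
    NonUnitalAlgHom.ext fun x => Subtype.ext (Prod.ext (h x) (h' x))
  -- These four identities link the moves: the end of each is the start of the next, and by `hLdec`
  -- and `hRdec` the chain starts at `sL` and ends at `sR`.
  have e₁ : τ₀.comp (idA.prod h₀) = sL :=
    ext_iff _ _ (fun a => rfl) fun a => (qτ₀ (a, h₀ a)).trans (hLdec a).symm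
  have e₂ : τ₀.comp (idA.prod h₁) = τ₁.comp sL :=
    ext_iff _ _ (fun a => rfl) fun a => (qτ₀ (a, h₁ a)).trans (qτ₁ (sL a)).symm
  have e₃ : τ₁.comp sM = τ₂.comp sM :=
    ext_iff _ _ (fun a => rfl) fun a => (qτ₁ (sM a)).trans (qτ₂ (sM a)).symm
  have e₄ : τ₂.comp sR = sR :=
    ext_iff _ _ (fun a => rfl) fun a => (qτ₂ (sR a)).trans (hRdec a).symm
  have k₀ : τ₀.comp (NonUnitalAlgHom.inr ℂ A J) = k.comp (cJ 0) :=
    ext_iff _ _ (fun a => rfl) fun y =>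
      (qτ₀ (0, y)).trans (Eq.trans (by simp) (hc 0 y).symm)
  have k₁ : τ₁.comp k = k.comp (cJ 1) := ext_iff _ _ (fun a => rfl) fun y =>
    (qτ₁ (k y)).trans (by
      rw [show p (k y) = 0 from rfl, map_zero, map_zero, map_zero, map_zero, map_zero, zero_add,
        add_zero]
      exact (hc 1 y).symm)
  have k₂ : τ₂.comp k = k.comp (cJ 2) := ext_iff _ _ (fun a => rfl) fun y =>
    (qτ₂ (k y)).trans (by
      rw [show p (k y) = 0 from rfl, map_zero, map_zero, map_zero, map_zero, map_zero, zero_add,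
        zero_add]
      exact (hc 2 y).symm)
  have hex := hF.induced k p sL (fun y y' h => hι (congrArg (fun e : E => e.1.2) h))
    (fun e => by
      constructor
      · intro he
        obtain ⟨y, hy⟩ := hpq e
        refine ⟨y, Subtype.ext (Prod.ext he.symm ?_)⟩
        rw [he, map_zero, sub_zero] at hy
        exact hy
      · rintro ⟨y, rfl⟩
        rfl) (fun _ => rfl)
  -- Two sections of `p` agree after applying `F p`, so their difference comes from F(J), where `τ₁`
  -- and `τ₂` act trivially.
  have hdiff : ∀ s s' : A →ₙₐ[ℂ] E, p.comp s = idA → p.comp s' = idA → ∀ x,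
      ∃ y, induced F k y = induced F s x - induced F s' x := fun s s' hs hs' x =>
    (hex.2 _).1 (by rw [map_sub, ← induced_comp, ← induced_comp, hs, hs', sub_self])
  obtain ⟨y, hy⟩ := hdiff sL sM rfl rfl x
  obtain ⟨z, hz⟩ := hdiff sM sR rfl rfl x
  have d₀ : induced F sL x - induced F (τ₁.comp sL) x =
      induced F k (induced F h₀ x - induced F h₁ x) := by
    rw [← e₂, ← e₁, induced_comp, induced_comp F τ₀, hF.induced_graph, hF.induced_graph, map_add,
      map_add, ← induced_comp F τ₀ (NonUnitalAlgHom.inr ℂ A J),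
      ← induced_comp F τ₀ (NonUnitalAlgHom.inr ℂ A J), k₀, induced_comp F k, hcF,
      induced_comp F k, hcF, map_sub]
    abel
  have d₁ : induced F (τ₁.comp sL) x - induced F (τ₁.comp sM) x =
      induced F sL x - induced F sM x := by
    rw [induced_comp, induced_comp F τ₁, ← map_sub, ← hy, ← induced_comp, k₁, induced_comp, hcF]
  have d₂ : induced F (τ₂.comp sM) x - induced F (τ₂.comp sR) x =
      induced F sM x - induced F sR x := by
    rw [induced_comp, induced_comp F τ₂, ← map_sub, ← hz, ← induced_comp, k₂, induced_comp, hcF]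
  -- Adding `d₁` and `d₂` telescopes to F(τ₁ sL) − F(sR) = F(sL) − F(sR); so F(τ₁ sL) = F(sL) and
  -- the left side of `d₀` vanishes.
  have : induced F k (induced F h₀ x - induced F h₁ x) = 0 := by
    rw [e₄, ← e₃] at d₂
    rw [← d₀]
    have h := congrArg₂ (· + ·) d₁ d₂
    simp only [sub_add_sub_cancel] at h
    rw [sub_left_inj] at h
    rw [h, sub_self]
  exact sub_eq_zero.1 (hex.1 (this.trans (map_zero _).symm))

end Swindle

end BornK

/-! ### I_S(A) as an ideal in the algebra of bounded matrices. -/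

namespace BornK

noncomputable section

/-- The symmetric ideal of all bounded sequences. -/
def linf : SymmIdeal where
  carrier := {α | ∃ C : ℝ, ∀ n, ‖α n‖ ≤ C}
  bounded _ hα := hα
  zero_mem := ⟨0, by simp⟩
  add_mem := by
    rintro α ⟨C, hC⟩ β ⟨D, hD⟩
    exact ⟨C + D, fun n => (norm_add_le _ _).trans (add_le_add (hC n) (hD n))⟩
  mul_mem := by
    rintro β ⟨D, hD⟩ α ⟨C, hC⟩
    refine ⟨D * C, fun n => ?_⟩
    rw [Pi.mul_apply, norm_mul]
    exact mul_le_mul (hD n) (hC n) (norm_nonneg _) ((norm_nonneg _).trans (hD n))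
  push_mem := by
    rintro f α ⟨C, hC⟩
    refine ⟨C, fun n => ?_⟩
    rcases hm : f.symm n with _ | m
    · simpa [pushSeq, hm] using (norm_nonneg _).trans (hC 0)
    · simpa [pushSeq, hm] using hC m

section Products

variable {S T : SymmIdeal} {A : Type*} [NonUnitalRing A] [Module ℂ A] [Bornology A]
  [BornologicalAlgebra A]

theorem MemI.mono {a : ℕ → ℕ → A} (h : S.carrier ⊆ T.carrier) (ha : MemI S a) : MemI T a := by
  obtain ⟨ha, D, hD, hD', haD, haS⟩ := ha
  exact ⟨ha, D, hD, hD', haD, h haS⟩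

/-- A finite set of at most `N` natural numbers is the image of `{0, …, N - 1}`. -/
theorem exists_enumeration {N : ℕ} (s : ℕ → Finset ℕ) (hcard : ∀ k, (s k).card ≤ N) :
    ∃ e : ℕ → ℕ → ℕ, ∀ k, ∀ j ∈ s k, ∃ t < N, e k t = j := by
  refine ⟨fun k t => (s k).toList.getD t 0, fun k j hj => ?_⟩
  obtain ⟨t, ht, htj⟩ := List.mem_iff_getElem.1 (Finset.mem_toList.2 hj)
  refine ⟨t, ?_, ?_⟩
  · rw [Finset.length_toList] at ht
    exact ht.trans_le (hcard k)
  · simp only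
    rw [List.getD_eq_getElem _ _ ht, htj]

/-- A family dominated by a sum of `N` finite-to-one reindexings of a member of `S` is in `S`. -/
theorem SymmIdeal.mem_of_le_sum (S : SymmIdeal) {α : ℕ → ℝ}
    (hα : (fun n => (α n : ℂ)) ∈ S.carrier) {C : ℝ} {N M : ℕ} (B : ℕ → Set ℕ)
    (φ : ℕ → ℕ → ℕ) (hfib : ∀ t m, {n | n ∈ B t ∧ φ t n = m}.encard ≤ M) {β : ℕ → ℝ}
    (hβ0 : ∀ n, 0 ≤ β n)
    (hβ : ∀ n, β n ≤ C * ∑ t ∈ Finset.range N, (B t).indicator (fun n => α (φ t n)) n) :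
    (fun n => (β n : ℂ)) ∈ S.carrier := by
  have hS := S.smul_mem (C : ℂ) (S.sum_mem (Finset.range N)
    (fun t => (B t).indicator fun n => (α (φ t n) : ℂ))
    (fun t _ => S.finiteToOne_mem hα (B t) (φ t) M (hfib t)))
  refine S.mem_of_norm_le hS fun n => ?_
  have hrhs : (C : ℂ) * (∑ t ∈ Finset.range N, (B t).indicator fun n => (α (φ t n) : ℂ)) n
      = ((C * ∑ t ∈ Finset.range N, (B t).indicator (fun n => α (φ t n)) n : ℝ) : ℂ) := by
    rw [Finset.sum_apply]
    push_cast
    congr 1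
    refine Finset.sum_congr rfl fun t _ => ?_
    by_cases h : n ∈ B t <;> simp [h]
  rw [hrhs, Complex.norm_real, Complex.norm_real, Real.norm_of_nonneg (hβ0 n),
    Real.norm_of_nonneg ((hβ0 n).trans (hβ n))]
  exact hβ n

/-- The enumeration `e` may repeat values or leave `s`; since the weights are nonnegative this only
enlarges the right side. Restricting to `P` is what later keeps the fibres of the reindexing maps
bounded. -/
theorem sum_le_sum_range_indicator {N : ℕ} {s : Finset ℕ} {e : ℕ → ℕ} {P : ℕ → Prop}
    [DecidablePred P] (he : ∀ j ∈ s, ∃ t < N, e t = j) (hP : ∀ j ∈ s, P j) {w : ℕ → ℝ}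
    (hw : ∀ j, 0 ≤ w j) :
    ∑ j ∈ s, w j ≤ ∑ t ∈ Finset.range N, if P (e t) then w (e t) else 0 := by
  let R := (Finset.range N).filter fun t => P (e t)
  have hR : s ⊆ R.image e := by
    intro j hj
    obtain ⟨t, ht, rfl⟩ := he j hj
    exact Finset.mem_image.2 ⟨t, by simp [R, ht, hP _ hj], rfl⟩
  calc ∑ j ∈ s, w j ≤ ∑ j ∈ R.image e, w j :=
        Finset.sum_le_sum_of_subset_of_nonneg hR fun _ _ _ => hw _
    _ ≤ ∑ t ∈ R, w (e t) := Finset.sum_image_le_of_nonneg fun _ _ => hw _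
    _ = _ := by rw [Finset.sum_filter]

theorem MemI.exists_bound {a : ℕ → ℕ → A} (ha : MemI S a) :
    ∃ D : Set A, IsBounded D ∧ IsBanachDisk D ∧ (∀ i j, a i j ∈ diskSpan D) ∧
      (fun n : ℕ => (diskNorm D (a n.unpair.1 n.unpair.2) : ℂ)) ∈ S.carrier ∧
      ∃ C, 0 ≤ C ∧ ∀ i j, diskNorm D (a i j) ≤ C := by
  obtain ⟨ha, D, hD, hD', haD, haS⟩ := ha
  obtain ⟨C, hC⟩ := S.bounded _ haS
  have hC' : ∀ i j, diskNorm D (a i j) ≤ C := fun i j => by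
    have := hC (Nat.pairEquiv (i, j))
    simpa [Complex.norm_real, abs_of_nonneg (diskNorm_nonneg D _)] using this
  exact ⟨D, hD, hD', fun i j => by simpa using haD (Nat.pairEquiv (i, j)), haS, C,
    (diskNorm_nonneg _ _).trans (hC' 0 0), hC'⟩

theorem card_le_of_encard_le {s : Set ℕ} {N : ℕ} (hs : s.Finite) (h : s.encard ≤ N) :
    hs.toFinset.card ≤ N := by
  rw [hs.encard_eq_coe_toFinset_card] at h
  exact_mod_cast h

/-- Column k of `b` has at most N nonzero entries, at rows `e k t` with t < N, so entry (i, k) of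
the product is bounded by C times a sum of N entries of `a`. Only boundedness of the entries of `b`
is needed. -/
theorem MemI.mul_of_left {a b : ℕ → ℕ → A} (ha : MemI S a) (hb : MemI T b) :
    MemI S (matMul a b) := by
  classical
  obtain ⟨D, hD, hD', haD, haS, -⟩ := ha.exists_bound
  obtain ⟨E, hE, hE', hbE, -, C, hC0, hC⟩ := hb.exists_bound
  obtain ⟨G, hG, hG', hsub⟩ := exists_bounded_disk (D * E)
    (BornologicalAlgebra.isBounded_mul D E hD hE)
  have hab : ∀ i j k, a i j * b j k ∈ diskSpan G := fun i j k =>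
    mul_mem_diskSpan hsub (haD i j) (hbE j k)
  have hsum : ∀ i k, matMul a b i k = ∑ j ∈ (hb.1.col_finite k).toFinset, a i j * b j k :=
    fun i k => matMul_eq_sum_col a i k _ fun j hj => by simpa using hj
  refine ⟨ha.1.mul hb.1, G, hG, hG', fun n => ?_, ?_⟩
  · change matMul a b n.unpair.1 n.unpair.2 ∈ diskSpan G
    rw [hsum]
    exact Submodule.sum_mem _ fun j _ => hab _ j _
  obtain ⟨N, hrow, hcol⟩ := hb.1
  obtain ⟨e, he⟩ := exists_enumeration (fun k => (hb.1.col_finite k).toFinset)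
    fun k => card_le_of_encard_le _ (hcol k)
  -- The reindexing (i, k) ↦ (i, `e k t`), restricted to nonzero entries of `b`, is at most
  -- N-to-one: a fibre injects into the set of nonzero entries in one row of `b`.
  refine S.mem_of_le_sum haS (C := C) (N := N) (M := N)
    (fun t => {n | b (e n.unpair.2 t) n.unpair.2 ≠ 0})
    (fun t n => Nat.pair n.unpair.1 (e n.unpair.2 t)) (fun t m => ?_)
    (fun n => diskNorm_nonneg _ _) fun n => ?_
  · refine le_trans ?_ (hrow m.unpair.2)
    rw [← Set.InjOn.encard_image (f := fun n : ℕ => n.unpair.2)]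
    · refine Set.encard_le_encard ?_
      rintro _ ⟨n, ⟨hn, rfl⟩, rfl⟩
      simpa using hn
    · rintro x ⟨-, rfl⟩ y ⟨-, hy⟩ hxy
      have h1 := congrArg (fun n : ℕ => n.unpair.1) hy
      simp only [Nat.unpair_pair] at h1 hxy
      rw [← Nat.pair_unpair x, ← Nat.pair_unpair y, h1, hxy]
  · change diskNorm G (matMul a b n.unpair.1 n.unpair.2) ≤ _
    rw [hsum]
    refine (hG'.toIsDisk.diskNorm_sum_le _ _ fun j => hab _ j _).trans ?_
    refine (Finset.sum_le_sum (g := fun j => C * diskNorm D (a n.unpair.1 j))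
      fun j _ => ?_).trans ?_
    · refine (diskNorm_mul_le hD'.toIsDisk hE'.toIsDisk hsub (haD _ j) (hbE j _)).trans ?_
      rw [mul_comm]
      exact mul_le_mul_of_nonneg_right (hC j _) (diskNorm_nonneg _ _)
    rw [← Finset.mul_sum]
    refine mul_le_mul_of_nonneg_left ?_ hC0
    refine (sum_le_sum_range_indicator (he n.unpair.2) (P := fun j => b j n.unpair.2 ≠ 0)
      (fun j hj => by simpa using hj) fun _ => diskNorm_nonneg _ _).trans_eq ?_
    refine Finset.sum_congr rfl fun t _ => ?_
    rw [Set.indicator_apply]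
    simp only [Nat.unpair_pair]
    rfl

/-- The mirror image of `MemI.mul_of_left`: enumerate the rows of `a` and bound the fibres of (i, k)
↦ (`e i t`, k) by the columns of `a`. -/
theorem MemI.mul_of_right {a b : ℕ → ℕ → A} (ha : MemI T a) (hb : MemI S b) :
    MemI S (matMul a b) := by
  classical
  obtain ⟨D, hD, hD', haD, -, C, hC0, hC⟩ := ha.exists_bound
  obtain ⟨E, hE, hE', hbE, hbS, -⟩ := hb.exists_bound
  obtain ⟨G, hG, hG', hsub⟩ := exists_bounded_disk (D * E)
    (BornologicalAlgebra.isBounded_mul D E hD hE)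
  have hab : ∀ i j k, a i j * b j k ∈ diskSpan G := fun i j k =>
    mul_mem_diskSpan hsub (haD i j) (hbE j k)
  have hsum : ∀ i k, matMul a b i k = ∑ j ∈ (ha.1.row_finite i).toFinset, a i j * b j k :=
    fun i k => matMul_eq_sum_row b i k _ fun j hj => by simpa using hj
  refine ⟨ha.1.mul hb.1, G, hG, hG', fun n => ?_, ?_⟩
  · change matMul a b n.unpair.1 n.unpair.2 ∈ diskSpan G
    rw [hsum]
    exact Submodule.sum_mem _ fun j _ => hab _ j _
  obtain ⟨N, hrow, hcol⟩ := ha.1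
  obtain ⟨e, he⟩ := exists_enumeration (fun i => (ha.1.row_finite i).toFinset)
    fun i => card_le_of_encard_le _ (hrow i)
  refine S.mem_of_le_sum hbS (C := C) (N := N) (M := N)
    (fun t => {n | a n.unpair.1 (e n.unpair.1 t) ≠ 0})
    (fun t n => Nat.pair (e n.unpair.1 t) n.unpair.2) (fun t m => ?_)
    (fun n => diskNorm_nonneg _ _) fun n => ?_
  · refine le_trans ?_ (hcol m.unpair.1)
    rw [← Set.InjOn.encard_image (f := fun n : ℕ => n.unpair.1)]
    · refine Set.encard_le_encard ?_
      rintro _ ⟨n, ⟨hn, rfl⟩, rfl⟩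
      simpa using hn
    · rintro x ⟨-, rfl⟩ y ⟨-, hy⟩ hxy
      have h1 := congrArg (fun n : ℕ => n.unpair.2) hy
      simp only [Nat.unpair_pair] at h1 hxy
      rw [← Nat.pair_unpair x, ← Nat.pair_unpair y, h1, hxy]
  · change diskNorm G (matMul a b n.unpair.1 n.unpair.2) ≤ _
    rw [hsum]
    refine (hG'.toIsDisk.diskNorm_sum_le _ _ fun j => hab _ j _).trans ?_
    refine (Finset.sum_le_sum (g := fun j => C * diskNorm E (b j n.unpair.2))
      fun j _ => ?_).trans ?_
    · refine (diskNorm_mul_le hD'.toIsDisk hE'.toIsDisk hsub (haD _ j) (hbE j _)).trans ?_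
      exact mul_le_mul_of_nonneg_right (hC _ j) (diskNorm_nonneg _ _)
    rw [← Finset.mul_sum]
    refine mul_le_mul_of_nonneg_left ?_ hC0
    refine (sum_le_sum_range_indicator (he n.unpair.1) (P := fun j => a n.unpair.1 j ≠ 0)
      (fun j hj => by simpa using hj) fun _ => diskNorm_nonneg _ _).trans_eq ?_
    refine Finset.sum_congr rfl fun t _ => ?_
    rw [Set.indicator_apply]
    simp only [Nat.unpair_pair]
    rfl

variable (S A) in
/-- The inclusion of `I_{S(A)}` into the algebra of bounded matrices. -/
def IAlg.incl : IAlg S A →ₙₐ[ℂ] IAlg linf A where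
  toFun a := IAlg.mk a.entries (a.memI.mono S.bounded)
  map_smul' _ _ := rfl
  map_zero' := rfl
  map_add' _ _ := rfl
  map_mul' _ _ := rfl

theorem IAlg.incl_injective : Function.Injective (IAlg.incl S A) := fun _ _ h =>
  IAlg.ext fun i j => congrFun (congrFun (congrArg IAlg.entries h) i) j

theorem IAlg.exists_incl_eq_mul (g : IAlg linf A) (x : IAlg S A) :
    ∃ y, IAlg.incl S A y = g * IAlg.incl S A x :=
  ⟨IAlg.mk _ (g.memI.mul_of_right x.memI), rfl⟩

theorem IAlg.exists_incl_eq_mul' (g : IAlg linf A) (x : IAlg S A) :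
    ∃ y, IAlg.incl S A y = IAlg.incl S A x * g :=
  ⟨IAlg.mk _ (x.memI.mul_of_left g.memI), rfl⟩

end Products

/-! ### Moving rows and columns along injections of ℕ. -/

section Spread

/-- The matrix `a` with its rows moved along `f` and its columns moved along `g`. -/
def spread {A : Type*} [Zero A] (f g : ℕ → ℕ) (a : ℕ → ℕ → A) : ℕ → ℕ → A := fun m n =>
  Function.extend (Prod.map f g) (Function.uncurry a) 0 (m, n)

section Zero

variable {A : Type*} [Zero A] {f g : ℕ → ℕ} (a : ℕ → ℕ → A)

theorem spread_apply (hf : Function.Injective f) (hg : Function.Injective g) (i k : ℕ) :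
    spread f g a (f i) (g k) = a i k :=
  (hf.prodMap hg).extend_apply (Function.uncurry a) 0 (i, k)

theorem spread_of_left {m : ℕ} (hm : m ∉ Set.range f) (n : ℕ) : spread f g a m n = 0 :=
  Function.extend_apply' _ _ _ (by rintro ⟨p, hp⟩; exact hm ⟨p.1, congrArg Prod.fst hp⟩)

theorem spread_of_right (m : ℕ) {n : ℕ} (hn : n ∉ Set.range g) : spread f g a m n = 0 :=
  Function.extend_apply' _ _ _ (by rintro ⟨p, hp⟩; exact hn ⟨p.2, congrArg Prod.snd hp⟩)

theorem exists_of_spread_ne_zero (hf : Function.Injective f) (hg : Function.Injective g)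
    {m n : ℕ} (h : spread f g a m n ≠ 0) : ∃ i k, f i = m ∧ g k = n ∧ a i k ≠ 0 := by
  by_cases hm : m ∈ Set.range f
  · by_cases hn : n ∈ Set.range g
    · obtain ⟨i, rfl⟩ := hm
      obtain ⟨k, rfl⟩ := hn
      exact ⟨i, k, rfl, rfl, by rwa [spread_apply a hf hg] at h⟩
    · exact absurd (spread_of_right a m hn) h
  · exact absurd (spread_of_left a hm n) h

theorem RowColBounded.spread {a : ℕ → ℕ → A} (ha : RowColBounded a) (hf : Function.Injective f)
    (hg : Function.Injective g) : RowColBounded (spread f g a) := by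
  obtain ⟨N, hrow, hcol⟩ := ha
  refine ⟨N, fun m => ?_, fun n => ?_⟩
  · by_cases hm : m ∈ Set.range f
    · obtain ⟨i, rfl⟩ := hm
      refine le_trans ?_ ((Set.encard_image_le g _).trans (hrow i))
      refine Set.encard_le_encard fun n hn => ?_
      obtain ⟨i', k, hi, rfl, h⟩ := exists_of_spread_ne_zero a hf hg hn
      exact ⟨k, by rwa [← hf hi], rfl⟩
    · simp [spread_of_left a hm]
  · by_cases hn : n ∈ Set.range g
    · obtain ⟨k, rfl⟩ := hn
      refine le_trans ?_ ((Set.encard_image_le f _).trans (hcol k))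
      refine Set.encard_le_encard fun m hm => ?_
      obtain ⟨i, k', rfl, hk, h⟩ := exists_of_spread_ne_zero a hf hg hm
      exact ⟨i, by rwa [← hg hk], rfl⟩
    · simp [spread_of_right a _ hn]

end Zero

variable {S : SymmIdeal} {A : Type*} [NonUnitalRing A] [Module ℂ A] {f g h : ℕ → ℕ}

/-- Let V_f be the 0-1 matrix of f. Then `spread f g a` is V_f a V_gᵗ, and V_gᵗ V_g = 1 because g is
injective. -/
theorem matMul_spread (a b : ℕ → ℕ → A) (hf : Function.Injective f) (hg : Function.Injective g)
    (hh : Function.Injective h) :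
    matMul (spread f g a) (spread g h b) = spread f h (matMul a b) := by
  funext m n
  by_cases hm : m ∈ Set.range f
  · by_cases hn : n ∈ Set.range h
    · obtain ⟨i, rfl⟩ := hm
      obtain ⟨k, rfl⟩ := hn
      rw [spread_apply _ hf hh]
      unfold matMul
      rw [← finsum_mem_univ, finsum_mem_inter_support_eq' _ Set.univ (Set.range g),
        finsum_mem_range hg]
      · simp only [spread_apply _ hf hg, spread_apply _ hg hh]
      · intro j hj
        simp only [Set.mem_univ, true_iff]
        by_contra hj'
        exact hj (by simp [spread_of_right a _ hj'])
    · rw [spread_of_right _ _ hn]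
      simp [matMul, spread_of_right b _ hn]
  · rw [spread_of_left _ hm]
    simp [matMul, spread_of_left a hm]

/-- Here V_gᵗ V_g' = 0. This gives the orthogonality of the three blocks in the swindle. -/
theorem matMul_spread_of_disjoint {g' : ℕ → ℕ} (a b : ℕ → ℕ → A)
    (hd : Disjoint (Set.range g) (Set.range g')) :
    matMul (spread f g a) (spread g' h b) = 0 := by
  funext m n
  refine finsum_eq_zero_of_forall_eq_zero fun j => ?_
  by_cases hj : j ∈ Set.range g
  · rw [spread_of_left b (Set.disjoint_left.1 hd hj), mul_zero]
  · rw [spread_of_right a _ hj, zero_mul]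

variable [Bornology A] [BornologicalAlgebra A]

/-- The entries of the new matrix are those of `a`, reindexed injectively and extended by zero. -/
theorem MemI.spread {a : ℕ → ℕ → A} (ha : MemI S a) (hf : Function.Injective f)
    (hg : Function.Injective g) : MemI S (spread f g a) := by
  obtain ⟨ha, D, hD, hD', haD, haS⟩ := ha
  refine ⟨ha.spread hf hg, D, hD, hD', fun n => ?_, ?_⟩
  · change BornK.spread f g a n.unpair.1 n.unpair.2 ∈ diskSpan D
    by_cases h0 : BornK.spread f g a n.unpair.1 n.unpair.2 = 0
    · rw [h0]; exact Submodule.zero_mem _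
    · obtain ⟨i, k, hi, hk, -⟩ := exists_of_spread_ne_zero a hf hg h0
      rw [← hi, ← hk, spread_apply a hf hg]
      simpa using haD (Nat.pairEquiv (i, k))
  · have hinj : Set.InjOn
        (fun n : ℕ => Nat.pair (Function.invFun f n.unpair.1) (Function.invFun g n.unpair.2))
        {n : ℕ | n.unpair.1 ∈ Set.range f ∧ n.unpair.2 ∈ Set.range g} := by
      rintro x ⟨⟨i, hi⟩, ⟨k, hk⟩⟩ y ⟨⟨i', hi'⟩, ⟨k', hk'⟩⟩ hxy
      simp only [← hi, ← hk, ← hi', ← hk', Function.leftInverse_invFun hf _,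
        Function.leftInverse_invFun hg _, Nat.pair_eq_pair] at hxy
      rw [← Nat.pair_unpair x, ← Nat.pair_unpair y, ← hi, ← hk, ← hi', ← hk', hxy.1, hxy.2]
    convert S.indicator_mem haS _ _ hinj using 1
    funext n
    by_cases hm : n.unpair.1 ∈ Set.range f
    · by_cases hn : n.unpair.2 ∈ Set.range g
      · rw [Set.indicator_of_mem (by exact ⟨hm, hn⟩)]
        obtain ⟨i, hi⟩ := hm
        obtain ⟨k, hk⟩ := hn
        simp [← hi, ← hk, spread_apply a hf hg, Function.leftInverse_invFun hf _,
          Function.leftInverse_invFun hg _]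
      · rw [Set.indicator_of_notMem (fun h => hn h.2)]
        simp [spread_of_right a _ hn]
    · rw [Set.indicator_of_notMem (fun h => hm h.1)]
      simp [spread_of_left a hm]

/-- Moving rows and columns along injections, as a linear map. -/
def IAlg.spreadₗ (hf : Function.Injective f) (hg : Function.Injective g) :
    IAlg S A →ₗ[ℂ] IAlg S A where
  toFun a := IAlg.mk (spread f g a.entries) (a.memI.spread hf hg)
  map_add' a b := IAlg.ext fun m n => by
    change spread f g (a + b).entries m n = spread f g a.entries m n + spread f g b.entries m n
    by_cases hm : m ∈ Set.range f
    · by_cases hn : n ∈ Set.range g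
      · obtain ⟨i, rfl⟩ := hm
        obtain ⟨k, rfl⟩ := hn
        simp only [spread_apply _ hf hg, IAlg.entries_add]
      · simp only [spread_of_right _ _ hn, add_zero]
    · simp only [spread_of_left _ hm, add_zero]
  map_smul' c a := IAlg.ext fun m n => by
    change spread f g (c • a).entries m n = c • spread f g a.entries m n
    by_cases hm : m ∈ Set.range f
    · by_cases hn : n ∈ Set.range g
      · obtain ⟨i, rfl⟩ := hm
        obtain ⟨k, rfl⟩ := hn
        simp only [spread_apply _ hf hg, IAlg.entries_smul]
      · simp only [spread_of_right _ _ hn, smul_zero]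
    · simp only [spread_of_left _ hm, smul_zero]

theorem IAlg.spreadₗ_mul (hf : Function.Injective f) (hg : Function.Injective g)
    (hh : Function.Injective h) (a b : IAlg S A) :
    IAlg.spreadₗ hf hg a * IAlg.spreadₗ hg hh b = IAlg.spreadₗ hf hh (a * b) :=
  Subtype.ext (matMul_spread _ _ hf hg hh)

theorem IAlg.spreadₗ_id (a : IAlg S A) :
    IAlg.spreadₗ Function.injective_id Function.injective_id a = a :=
  IAlg.ext fun i j => spread_apply _ Function.injective_id Function.injective_id i j

variable (S A) in
/-- The endomorphism of `I_{S(A)}` induced by an injection of `ℕ`. -/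
def IAlg.spreadHom (hf : Function.Injective f) : IAlg S A →ₙₐ[ℂ] IAlg S A :=
  { IAlg.spreadₗ hf hf with
    map_zero' := map_zero (IAlg.spreadₗ hf hf)
    map_mul' := fun a b => (IAlg.spreadₗ_mul hf hf hf a b).symm }

theorem IAlg.entries_spreadHom (hf : Function.Injective f) (a : IAlg S A) :
    (IAlg.spreadHom S A hf a).entries = spread f f a.entries := rfl

end Spread

/-- The endomorphism is x ↦ V_f x V_fᵗ with V_fᵗ V_f = 1. As V_f need not be a matrix over A, it
enters only as a multiplier, through the four linear maps spreading along `f` or the identity on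
either side. -/
theorem M2Stable.induced_spreadHom {F : Alg.{u} ⥤ AddCommGrpCat.{v}} (hF : M2Stable F)
    (S : SymmIdeal) (A : Type u) [NonUnitalRing A] [Module ℂ A] [Bornology A]
    [BornologicalAlgebra A] {f : ℕ → ℕ} (hf : Function.Injective f)
    (x : F.obj (Alg.mk (IAlg S A))) : induced F (IAlg.spreadHom S A hf) x = x := by
  have hv : ∀ i, Function.Injective (![f, id] i) := by
    intro i
    fin_cases i
    · exact hf
    · exact Function.injective_id
  exact hF.induced_eq_self (fun i j => IAlg.spreadₗ (hv i) (hv j))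
    (fun i j k x y => IAlg.spreadₗ_mul _ _ _ x y) (fun x => IAlg.spreadₗ_id x)
    (IAlg.spreadHom S A hf) (fun x => rfl) x

/-! ### Block diagonal homomorphisms and the binary tree. -/

section BlockDiagonal

variable {S : SymmIdeal} {A B : Type*} [NonUnitalRing A] [Module ℂ A] [Bornology A]
  [BornologicalAlgebra A] [NonUnitalRing B] [Module ℂ B] [Bornology B] [BornologicalAlgebra B]

/-- The block diagonal matrix with blocks `K k (a)`, indexed by `ℕ × ℕ ≃ ℕ`. -/
def blockEntries (K : ℕ → A →ₙₐ[ℂ] B) (a : ℕ → ℕ → A) : ℕ → ℕ → B := fun m n =>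
  if m.unpair.1 = n.unpair.1 then K m.unpair.1 (a m.unpair.2 n.unpair.2) else 0

theorem RowColBounded.blockEntries (K : ℕ → A →ₙₐ[ℂ] B) {a : ℕ → ℕ → A} (ha : RowColBounded a) :
    RowColBounded (blockEntries K a) := by
  obtain ⟨N, hrow, hcol⟩ := ha
  have key : ∀ m n : ℕ, BornK.blockEntries K a m n ≠ 0 →
      m.unpair.1 = n.unpair.1 ∧ a m.unpair.2 n.unpair.2 ≠ 0 := by
    intro m n h
    unfold BornK.blockEntries at h
    split_ifs at h with h1
    · exact ⟨h1, fun h0 => h (by simp [h0])⟩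
    · exact absurd rfl h
  refine ⟨N, fun m => ?_, fun n => ?_⟩
  · refine le_trans ?_ (hrow m.unpair.2)
    refine le_trans (Set.encard_le_encard fun n hn => ?_)
      (Set.encard_image_le (fun j => Nat.pair m.unpair.1 j) _)
    obtain ⟨h1, h2⟩ := key m n hn
    exact ⟨n.unpair.2, h2, by simp [h1]⟩
  · refine le_trans ?_ (hcol n.unpair.2)
    refine le_trans (Set.encard_le_encard fun m hm => ?_)
      (Set.encard_image_le (fun i => Nat.pair n.unpair.1 i) _)
    obtain ⟨h1, h2⟩ := key m n hm
    exact ⟨m.unpair.2, h2, by simp [← h1]⟩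

/-- The image of a disk under a linear map with bounded values on the disk. -/
theorem IsDisk.diskNorm_map_le_mul {V W : Type*} [AddCommGroup V] [Module ℂ V] [AddCommGroup W]
    [Module ℂ W] {D : Set V} {E : Set W} (hD : IsDisk D) (hE : IsDisk E) (f : V →ₗ[ℂ] W) {C : ℝ}
    (h : ∀ x ∈ D, diskNorm E (f x) ≤ C) {x : V} (hx : x ∈ diskSpan D) :
    diskNorm E (f x) ≤ C * diskNorm D x := by
  -- The infimum defining the Minkowski functional need not be attained, so the bound is proved with
  -- slack ε.
  have hlim : Tendsto (fun ε : ℝ => C * (diskNorm D x + ε)) (𝓝[>] 0)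
      (𝓝 (C * (diskNorm D x + 0))) := by
    refine Tendsto.mono_left ?_ nhdsWithin_le_nhds
    exact Continuous.tendsto (by fun_prop) 0
  rw [add_zero] at hlim
  refine ge_of_tendsto hlim ?_
  filter_upwards [self_mem_nhdsWithin] with ε hε
  have hε' : 0 < diskNorm D x + ε := add_pos_of_nonneg_of_pos (diskNorm_nonneg D x) hε
  obtain ⟨d, hd, hdx⟩ := hD.mem_smul_of_lt hx (lt_add_of_pos_right _ hε)
  have hdx' : ((diskNorm D x + ε : ℝ) : ℂ) • d = x := by rw [Complex.coe_smul]; exact hdx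
  rw [← hdx', map_smul, hE.diskNorm_smul, hdx', Complex.norm_real, Real.norm_of_nonneg hε'.le,
    mul_comm]
  exact mul_le_mul_of_nonneg_right (h d hd) hε'.le

/-- An entry of `a` reappears in every block, so smallness is lost and only boundedness survives;
one disk `E` serves all blocks because the homomorphisms are jointly bounded on bounded sets. -/
theorem MemI.blockEntries {K : ℕ → A →ₙₐ[ℂ] B}
    (hK : ∀ s : Set A, IsBounded s → IsBounded (⋃ k, K k '' s)) {a : ℕ → ℕ → A} (ha : MemI S a) :
    MemI linf (blockEntries K a) := by
  obtain ⟨D, hD, hD', haD, -, C, hC0, hC⟩ := ha.exists_bound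
  obtain ⟨E, hE, hE', hsub⟩ := exists_bounded_disk _ (hK D hD)
  let g : ℕ → A →ₗ[ℂ] B := fun k =>
    { toFun := K k, map_add' := map_add (K k), map_smul' := map_smul (K k) }
  have hg : ∀ k, ∀ x ∈ D, g k x ∈ E := fun k x hx =>
    hsub (Set.mem_iUnion.2 ⟨k, x, hx, rfl⟩)
  refine ⟨ha.1.blockEntries K, E, hE, hE', fun N => ?_, C, fun N => ?_⟩
  all_goals
    generalize hm : (Nat.pairEquiv.symm N).1 = m
    generalize hn : (Nat.pairEquiv.symm N).2 = n
  · simp only [hm, hn]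
    unfold BornK.blockEntries
    split_ifs
    · exact map_mem_diskSpan (g _) (hg _) (haD _ _)
    · exact Submodule.zero_mem _
  · simp only [hm, hn]
    rw [Complex.norm_real, Real.norm_of_nonneg (diskNorm_nonneg _ _)]
    unfold BornK.blockEntries
    split_ifs
    · exact (hD'.toIsDisk.diskNorm_map_le (g _) (hg _) (haD _ _)).trans (hC _ _)
    · rwa [diskNorm_zero]

theorem matMul_blockEntries (K : ℕ → A →ₙₐ[ℂ] B) {a : ℕ → ℕ → A} (ha : RowColBounded a)
    (b : ℕ → ℕ → A) :
    blockEntries K (matMul a b) = matMul (blockEntries K a) (blockEntries K b) := by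
  classical
  funext m n
  rw [matMul_eq_sum_row (blockEntries K b) m n
    ((ha.row_finite m.unpair.2).toFinset.image fun j => Nat.pair m.unpair.1 j)]
  · rw [Finset.sum_image (by intro x _ y _ h; simpa using h)]
    simp only [blockEntries, Nat.unpair_pair]
    split_ifs with h
    · rw [matMul_eq_sum_row b _ _ (ha.row_finite m.unpair.2).toFinset (fun j hj => by simpa using hj),
        map_sum]
      simp
    · simp
  · intro l hl
    unfold blockEntries at hl
    split_ifs at hl with h1
    · refine Finset.mem_image.2 ⟨l.unpair.2, ?_, by simp [h1]⟩
      rw [Set.Finite.mem_toFinset]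
      exact fun h0 => hl (by simp [h0])
    · exact absurd rfl hl

/-- The homomorphism that sends `a` to the block diagonal matrix with blocks `K k (a)`. -/
def IAlg.block (S : SymmIdeal) (K : ℕ → A →ₙₐ[ℂ] B)
    (hK : ∀ s : Set A, IsBounded s → IsBounded (⋃ k, K k '' s)) :
    IAlg S A →ₙₐ[ℂ] IAlg linf B where
  toFun a := IAlg.mk (blockEntries K a.entries) (a.memI.blockEntries hK)
  map_smul' c a := IAlg.ext fun m n => by
    change blockEntries K (c • a).entries m n = c • blockEntries K a.entries m n
    unfold blockEntries
    split_ifs <;> simp [IAlg.entries_smul]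
  map_zero' := IAlg.ext fun m n => by
    change blockEntries K (0 : IAlg S A).entries m n = 0
    unfold blockEntries
    split_ifs <;> simp [IAlg.entries_zero]
  map_add' a b := IAlg.ext fun m n => by
    change blockEntries K (a + b).entries m n =
      blockEntries K a.entries m n + blockEntries K b.entries m n
    unfold blockEntries
    split_ifs <;> simp [IAlg.entries_add]
  map_mul' a b := Subtype.ext (matMul_blockEntries K a.memI.1 b.entries)

/-- Reduces the matrix condition to one about families: in `hd`, the first component of n is the
block and the second runs through the entries of `a`, listed as one sequence. -/
theorem IAlg.exists_incl_eq_block_sub {K K' : ℕ → A →ₙₐ[ℂ] B}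
    (hK : ∀ s : Set A, IsBounded s → IsBounded (⋃ k, K k '' s))
    (hK' : ∀ s : Set A, IsBounded s → IsBounded (⋃ k, K' k '' s))
    (hd : ∀ α ∈ S.seq A, (fun n : ℕ => K n.unpair.1 (α n.unpair.2) - K' n.unpair.1 (α n.unpair.2)) ∈
      S.seq B) (a : IAlg S A) :
    ∃ y, IAlg.incl S B y = IAlg.block S K hK a - IAlg.block S K' hK' a := by
  have hmem := (IAlg.block S K hK a - IAlg.block S K' hK' a).memI
  have hent : ∀ m n : ℕ, (IAlg.block S K hK a - IAlg.block S K' hK' a).entries m n =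
      if m.unpair.1 = n.unpair.1 then K m.unpair.1 (a.entries m.unpair.2 n.unpair.2) -
        K' m.unpair.1 (a.entries m.unpair.2 n.unpair.2) else 0 := by
    intro m n
    change blockEntries K a.entries m n - blockEntries K' a.entries m n = _
    unfold blockEntries
    split_ifs <;> simp
  obtain ⟨E, hE, hE', hβE, hβS⟩ := hd _ a.memI.2
  refine ⟨IAlg.mk (IAlg.block S K hK a - IAlg.block S K' hK' a).entries
    ⟨hmem.1, E, hE, hE', fun N => ?_, ?_⟩, rfl⟩
  · simp only [hent]
    split_ifs with h
    · simpa using hβE (Nat.pair (Nat.pairEquiv.symm N).1.unpair.1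
        (Nat.pair (Nat.pairEquiv.symm N).1.unpair.2 (Nat.pairEquiv.symm N).2.unpair.2))
    · exact Submodule.zero_mem _
  · have hinj : Set.InjOn (fun N : ℕ => Nat.pair N.unpair.1.unpair.1
        (Nat.pair N.unpair.1.unpair.2 N.unpair.2.unpair.2))
        {N : ℕ | N.unpair.1.unpair.1 = N.unpair.2.unpair.1} := by
      intro x hx y hy hxy
      simp only [Nat.pair_eq_pair] at hxy
      obtain ⟨h1, h2, h3⟩ := hxy
      rw [← Nat.pair_unpair x, ← Nat.pair_unpair y, ← Nat.pair_unpair x.unpair.1,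
        ← Nat.pair_unpair x.unpair.2, ← Nat.pair_unpair y.unpair.1, ← Nat.pair_unpair y.unpair.2,
        ← Set.mem_ofPred_eq.mp hx, ← Set.mem_ofPred_eq.mp hy, h1, h2, h3]
    convert S.indicator_mem hβS _ _ hinj using 1
    funext N
    simp only [hent, Set.indicator_apply]
    by_cases h : N.unpair.1.unpair.1 = N.unpair.2.unpair.1
    · simp [h]
    · simp [h]

/-- The embeddings of `ℕ × ℕ ≃ ℕ` as the root and as the two subtrees below the root, for the
numbering of the binary tree in which `k` has the children `2 * k + 1` and `2 * k + 2`. -/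
def treeEmb : Fin 3 → ℕ → ℕ :=
  ![fun n => Nat.pair 0 n, fun n => Nat.pair (2 * n.unpair.1 + 1) n.unpair.2,
    fun n => Nat.pair (2 * n.unpair.1 + 2) n.unpair.2]

theorem treeEmb_injective (i : Fin 3) : Function.Injective (treeEmb i) := by
  intro x y h
  fin_cases i
  · simpa [treeEmb] using h
  all_goals
    simp only [treeEmb, Fin.mk_one, Matrix.cons_val, Nat.pair_eq_pair, Fin.reduceFinMk] at h
    rw [← Nat.pair_unpair x, ← Nat.pair_unpair y, h.2, show x.unpair.1 = y.unpair.1 by omega]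

theorem treeEmb_disjoint {i j : Fin 3} (hij : i ≠ j) :
    Disjoint (Set.range (treeEmb i)) (Set.range (treeEmb j)) := by
  rw [Set.disjoint_left]
  rintro _ ⟨x, rfl⟩ ⟨y, h⟩
  fin_cases i <;> fin_cases j <;> simp [treeEmb, Nat.pair_eq_pair] at h hij <;> omega

theorem exists_treeEmb (m : ℕ) : ∃ i x, treeEmb i x = m := by
  obtain h | h | h : m.unpair.1 = 0 ∨ (∃ l, m.unpair.1 = 2 * l + 1) ∨ ∃ l, m.unpair.1 = 2 * l + 2 := by
    rcases Nat.even_or_odd' m.unpair.1 with ⟨l, hl | hl⟩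
    · rcases l with _ | l
      · exact Or.inl (by omega)
      · exact Or.inr (Or.inr ⟨l, by omega⟩)
    · exact Or.inr (Or.inl ⟨l, hl⟩)
  · exact ⟨0, m.unpair.2, by simp [treeEmb, ← h]⟩
  · obtain ⟨l, hl⟩ := h
    exact ⟨1, Nat.pair l m.unpair.2, by simp [treeEmb, ← hl]⟩
  · obtain ⟨l, hl⟩ := h
    exact ⟨2, Nat.pair l m.unpair.2, by simp [treeEmb, ← hl]⟩

/-- The tree is its root together with two copies of itself, so a block diagonal matrix indexed by
the tree splits along `treeEmb`. The hypotheses `h0`, `h1`, `h2` say which homomorphisms sit on the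
root and on the two subtrees. -/
theorem IAlg.block_eq_sum {K K₁ K₂ : ℕ → A →ₙₐ[ℂ] B} {f : A →ₙₐ[ℂ] B}
    (hf : ∀ s : Set A, IsBounded s → IsBounded (f '' s))
    (hK : ∀ s : Set A, IsBounded s → IsBounded (⋃ k, K k '' s))
    (hK₁ : ∀ s : Set A, IsBounded s → IsBounded (⋃ k, K₁ k '' s))
    (hK₂ : ∀ s : Set A, IsBounded s → IsBounded (⋃ k, K₂ k '' s))
    (h0 : K 0 = f) (h1 : ∀ k, K (2 * k + 1) = K₁ k) (h2 : ∀ k, K (2 * k + 2) = K₂ k)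
    (a : IAlg S A) :
    IAlg.block S K hK a =
      IAlg.spreadHom linf B (treeEmb_injective 0) (IAlg.incl S B (IAlg.map f hf a)) +
      IAlg.spreadHom linf B (treeEmb_injective 1) (IAlg.block S K₁ hK₁ a) +
      IAlg.spreadHom linf B (treeEmb_injective 2) (IAlg.block S K₂ hK₂ a) := by
  refine IAlg.ext fun m n => ?_
  rw [IAlg.entries_add, IAlg.entries_add, IAlg.entries_spreadHom, IAlg.entries_spreadHom,
    IAlg.entries_spreadHom]
  have hz : ∀ i j, i ≠ j → ∀ (b : ℕ → ℕ → B) x n,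
      spread (treeEmb j) (treeEmb j) b (treeEmb i x) n = 0 := fun i j hij b x n =>
    spread_of_left b (Set.disjoint_left.1 (treeEmb_disjoint hij) ⟨x, rfl⟩) n
  have hz' : ∀ i j, i ≠ j → ∀ (b : ℕ → ℕ → B) x m,
      spread (treeEmb j) (treeEmb j) b m (treeEmb i x) = 0 := fun i j hij b x m =>
    spread_of_right b m (Set.disjoint_left.1 (treeEmb_disjoint hij) ⟨x, rfl⟩)
  have hs : ∀ i (b : ℕ → ℕ → B) x y,
      spread (treeEmb i) (treeEmb i) b (treeEmb i x) (treeEmb i y) = b x y := fun i b x y =>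
    spread_apply b (treeEmb_injective i) (treeEmb_injective i) x y
  obtain ⟨i, x, rfl⟩ := exists_treeEmb m
  obtain ⟨j, y, rfl⟩ := exists_treeEmb n
  change blockEntries K a.entries _ _ = _
  -- If row and column lie in the same piece, only that piece contributes; otherwise every summand
  -- vanishes, and so does the left side, since the block numbers differ.
  by_cases hij : i = j
  · subst hij
    fin_cases i
    · change _ = spread (treeEmb 0) (treeEmb 0) _ (treeEmb 0 x) (treeEmb 0 y) +
        spread _ _ _ (treeEmb 0 x) (treeEmb 0 y) + spread _ _ _ (treeEmb 0 x) (treeEmb 0 y)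
      rw [hs, hz 0 1 (by decide), hz 0 2 (by decide), add_zero, add_zero]
      simp [blockEntries, treeEmb, h0]
      rfl
    · change _ = spread (treeEmb 0) (treeEmb 0) _ (treeEmb 1 x) (treeEmb 1 y) +
        spread _ _ _ (treeEmb 1 x) (treeEmb 1 y) + spread _ _ _ (treeEmb 1 x) (treeEmb 1 y)
      rw [hs, hz 1 0 (by decide), hz 1 2 (by decide), zero_add, add_zero]
      change _ = blockEntries K₁ a.entries x y
      simp [blockEntries, treeEmb, h1]
    · change _ = spread (treeEmb 0) (treeEmb 0) _ (treeEmb 2 x) (treeEmb 2 y) +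
        spread _ _ _ (treeEmb 2 x) (treeEmb 2 y) + spread _ _ _ (treeEmb 2 x) (treeEmb 2 y)
      rw [hs, hz 2 0 (by decide), hz 2 1 (by decide), zero_add, zero_add]
      change _ = blockEntries K₂ a.entries x y
      simp [blockEntries, treeEmb, h2]
  · have hzero : ∀ k (b : ℕ → ℕ → B),
        spread (treeEmb k) (treeEmb k) b (treeEmb i x) (treeEmb j y) = 0 := by
      intro k b
      by_cases hik : i = k
      · exact hz' j k (fun h => hij (hik.trans h.symm)) b y _
      · exact hz i k hik b x _
    rw [hzero, hzero, hzero, add_zero, add_zero]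
    refine if_neg ?_
    fin_cases i <;> fin_cases j <;> simp [treeEmb] at hij ⊢ <;> omega

end BlockDiagonal

end

end BornK

namespace BornK

noncomputable section

/-! ### Dyadic intervals numbered by the binary tree. -/

section DyadicTree

/-- The midpoint of two points of the unit interval. -/
def unitMid (x y : unitInterval) : unitInterval :=
  ⟨((x : ℝ) + y) / 2, by
    have := x.2.1; have := y.2.1; have := x.2.2; have := y.2.2
    constructor <;> linarith⟩

/-- The endpoints of the `k`-th dyadic subinterval of `[0, 1]`, where the halves of the `k`-th
interval have the numbers `2 * k + 1` and `2 * k + 2`. -/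
def dyadicEnds : ℕ → unitInterval × unitInterval
  | 0 => (0, 1)
  | n + 1 =>
    let e := dyadicEnds (n / 2)
    -- The interval being defined has number `n + 1`, so an even `n` gives an odd number, that is, a
    -- left half.
    if n % 2 = 0 then (e.1, unitMid e.1 e.2) else (unitMid e.1 e.2, e.2)

theorem dyadicEnds_zero : dyadicEnds 0 = (0, 1) := by
  rw [dyadicEnds]

/-- The midpoint of the `k`-th dyadic subinterval. -/
def dyadicMid (k : ℕ) : unitInterval := unitMid (dyadicEnds k).1 (dyadicEnds k).2

theorem dyadicEnds_left (k : ℕ) :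
    dyadicEnds (2 * k + 1) = ((dyadicEnds k).1, dyadicMid k) := by
  rw [dyadicEnds]
  simp [dyadicMid]

theorem dyadicEnds_right (k : ℕ) :
    dyadicEnds (2 * k + 2) = (dyadicMid k, (dyadicEnds k).2) := by
  rw [dyadicEnds, show (2 * k + 1) / 2 = k by omega, show (2 * k + 1) % 2 = 1 by omega]
  simp [dyadicMid]

/-- The bound is exact at the right end of each level. It is inherited by the halves: a child k of l
has k ≤ 2l + 2, so half of 2/(l+2) is 2/(2l+4) ≤ 2/(k+2). -/
theorem dyadicEnds_sub (k : ℕ) : 0 ≤ ((dyadicEnds k).2 : ℝ) - (dyadicEnds k).1 ∧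
    ((dyadicEnds k).2 : ℝ) - (dyadicEnds k).1 ≤ 2 / (k + 2) := by
  induction k using Nat.strong_induction_on with
  | _ k ih =>
    have half : ∀ l : ℕ, l < k → k ≤ 2 * l + 2 →
        0 ≤ (((dyadicEnds l).2 : ℝ) - (dyadicEnds l).1) / 2 ∧
        (((dyadicEnds l).2 : ℝ) - (dyadicEnds l).1) / 2 ≤ 2 / (k + 2) := by
      intro l hl hk
      obtain ⟨h0, h1⟩ := ih l hl
      refine ⟨by linarith, ?_⟩
      have hk' : (k : ℝ) ≤ 2 * l + 2 := by exact_mod_cast hk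
      calc (((dyadicEnds l).2 : ℝ) - (dyadicEnds l).1) / 2 ≤ 2 / (l + 2) / 2 := by linarith
        _ = 2 / (2 * l + 4) := by field_simp; ring
        _ ≤ 2 / (k + 2) := by
          refine div_le_div_of_nonneg_left (by norm_num) (by positivity) (by linarith)
    rcases Nat.even_or_odd' k with ⟨l, rfl | rfl⟩
    · rcases l with _ | l
      · simp [dyadicEnds_zero]
      · have h := half l (by omega) (by omega)
        rw [show 2 * (l + 1) = 2 * l + 2 by ring] at h ⊢
        rw [dyadicEnds_right]
        simp only [dyadicMid, unitMid]
        constructor <;> linarith [h.1, h.2]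
    · have h := half l (by omega) (by omega)
      rw [dyadicEnds_left]
      simp only [dyadicMid, unitMid]
      constructor <;> linarith [h.1, h.2]

theorem dist_dyadicEnds (k : ℕ) :
    dist (dyadicEnds k).2 (dyadicEnds k).1 ≤ 2 / ((k : ℝ) + 2) := by
  obtain ⟨h0, h1⟩ := dyadicEnds_sub k
  rwa [Subtype.dist_eq, Real.dist_eq, abs_of_nonneg h0]

theorem dist_dyadicMid (k : ℕ) :
    dist (dyadicMid k) (dyadicEnds k).1 ≤ 2 / ((k : ℝ) + 2) := by
  obtain ⟨h0, h1⟩ := dyadicEnds_sub k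
  have h : ((dyadicMid k : unitInterval) : ℝ) - (dyadicEnds k).1 =
      (((dyadicEnds k).2 : ℝ) - (dyadicEnds k).1) / 2 := by
    simp only [dyadicMid, unitMid]
    ring
  rw [Subtype.dist_eq, Real.dist_eq, h, abs_of_nonneg (by linarith)]
  linarith

end DyadicTree

/-! ### Evaluating a homotopy, and the reduction to an estimate. -/

section Evaluation

variable {A B : Type*} [NonUnitalRing A] [Module ℂ A] [NonUnitalRing B] [Module ℂ B] {T : Type*}

/-- The homomorphism `ev_t ∘ H`. -/
def evalHom (H : A →ₙₐ[ℂ] (T → B)) (t : T) : A →ₙₐ[ℂ] B where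
  toFun a := H a t
  map_smul' c a := by simp
  map_zero' := by simp
  map_add' a b := by simp
  map_mul' a b := by simp

/-- The linear map `ev_t ∘ H`. -/
def evalLin (H : A →ₙₐ[ℂ] (T → B)) (t : T) : A →ₗ[ℂ] B where
  toFun a := H a t
  map_smul' c a := by simp
  map_add' a b := by simp

theorem eval_mem_diskSpan (H : A →ₙₐ[ℂ] (T → B)) {D : Set A} {E : Set B} (t : T)
    (h : ∀ x ∈ D, H x t ∈ diskSpan E) {x : A} (hx : x ∈ diskSpan D) : H x t ∈ diskSpan E := by
  have : diskSpan D ≤ (diskSpan E).comap (evalLin H t) := Submodule.span_le.2 h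
  exact this hx

theorem IsDisk.diskNorm_eval_sub_le (H : A →ₙₐ[ℂ] (T → B)) {D : Set A} {E : Set B}
    (hD : IsDisk D) (hE : IsDisk E) (s t : T) {C : ℝ}
    (h : ∀ x ∈ D, diskNorm E (H x s - H x t) ≤ C) {x : A} (hx : x ∈ diskSpan D) :
    diskNorm E (H x s - H x t) ≤ C * diskNorm D x :=
  hD.diskNorm_map_le_mul hE (evalLin H s - evalLin H t) h hx

theorem isBounded_of_diskNorm_le {V : Type*} [AddCommGroup V] [Module ℂ V] [Bornology V]
    [CompleteBornologicalSpace V] {E s : Set V} (hE : IsBounded E) (hE' : IsDisk E)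
    (hs : ∀ x ∈ s, x ∈ diskSpan E) {C : ℝ} (hC : ∀ x ∈ s, diskNorm E x ≤ C) : IsBounded s := by
  -- A Minkowski functional at most C gives membership only in dilates by factors larger than C,
  -- hence `C + 1`.
  refine (CompleteBornologicalSpace.isBounded_smul ((C + 1 : ℝ) : ℂ) E hE).subset fun x hx => ?_
  obtain ⟨d, hd, hdx⟩ := hE'.mem_smul_of_lt (hs x hx) ((hC x hx).trans_lt (lt_add_one C))
  exact ⟨d, hd, by rw [← hdx]; exact Complex.coe_smul _ _⟩

end Evaluation

/-- Everything algebraic is settled here for an arbitrary symmetric ideal; what remains for c₀ and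
ℓ^p is `hd`, that a family of S paired with ever closer parameter values gives differences in S. -/
theorem map_eq_of_dyadic_swindle {F : Alg.{u} ⥤ AddCommGrpCat.{v}} (hF : SplitExact F)
    (hM : M2Stable F) (S : SymmIdeal) {A B : BornAlg.{u}} {f₀ f₁ : A ⟶ B}
    (H : A.carrier →ₙₐ[ℂ] (unitInterval → B.carrier))
    (hb : ∀ s : Set A.carrier, IsBounded s → IsBounded {y | ∃ x ∈ s, ∃ t, H x t = y})
    (h01 : ∀ a, H a 0 = f₀.toHom a ∧ H a 1 = f₁.toHom a)
    (hd : ∀ α ∈ S.seq A.carrier, ∀ s t : ℕ → unitInterval,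
      (∀ k : ℕ, dist (s k) (t k) ≤ 2 / ((k : ℝ) + 2)) →
      (fun n : ℕ => H (α n.unpair.2) (s n.unpair.1) - H (α n.unpair.2) (t n.unpair.1)) ∈
        S.seq B.carrier) :
    (I S ⋙ F).map f₀ = (I S ⋙ F).map f₁ := by
  have hK : ∀ t : ℕ → unitInterval, ∀ s : Set A.carrier, IsBounded s →
      IsBounded (⋃ k, evalHom H (t k) '' s) := fun t s hs => by
    refine (hb s hs).subset (Set.iUnion_subset fun k => ?_)
    rintro _ ⟨x, hx, rfl⟩
    exact ⟨x, hx, t k, rfl⟩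
  let L : ℕ → unitInterval := fun k => (dyadicEnds k).1
  let R : ℕ → unitInterval := fun k => (dyadicEnds k).2
  let φ : (ℕ → unitInterval) → (IAlg S A.carrier →ₙₐ[ℂ] IAlg linf B.carrier) := fun t =>
    IAlg.block S (fun k => evalHom H (t k)) (hK t)
  have hφ : ∀ s t : ℕ → unitInterval, (∀ k : ℕ, dist (s k) (t k) ≤ 2 / ((k : ℝ) + 2)) →
      ∀ a, ∃ y, IAlg.incl S B.carrier y = φ s a - φ t a := fun s t hst =>
    IAlg.exists_incl_eq_block_sub (hK s) (hK t) fun α hα => hd α hα s t hst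
  have key : ∀ x, induced F (IAlg.map (S := S) f₀.toHom f₀.isBounded_image) x =
      induced F (IAlg.map (S := S) f₁.toHom f₁.isBounded_image) x :=
    induced_eq_of_swindle hF (IAlg.incl S B.carrier) IAlg.incl_injective
      IAlg.exists_incl_eq_mul IAlg.exists_incl_eq_mul'
      (fun i => IAlg.spreadHom linf B.carrier (treeEmb_injective i))
      (fun i => IAlg.spreadHom S B.carrier (treeEmb_injective i)) (fun i x => rfl)
      (fun i j hij x y => Subtype.ext (matMul_spread_of_disjoint _ _ (treeEmb_disjoint hij)))
      (fun i x => hM.induced_spreadHom S B.carrier (treeEmb_injective i) x)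
      (IAlg.map f₀.toHom f₀.isBounded_image) (IAlg.map f₁.toHom f₁.isBounded_image)
      (φ L) (φ dyadicMid) (φ R) (hφ _ _ dist_dyadicMid) (hφ _ _ dist_dyadicEnds)
      -- Left ends: the root gives `f₀`, the left halves keep the left ends, and the right halves
      -- start at the midpoints. For right ends below, the left halves end at the midpoints.
      (IAlg.block_eq_sum f₀.isBounded_image (hK L) (hK L) (hK dyadicMid)
        (NonUnitalAlgHom.ext fun a => by
          simp only [L, dyadicEnds_zero]
          exact (h01 a).1)
        (fun k => by simp only [L, dyadicEnds_left]) (fun k => by simp only [L, dyadicEnds_right]))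
      (IAlg.block_eq_sum f₁.isBounded_image (hK R) (hK dyadicMid) (hK R)
        (NonUnitalAlgHom.ext fun a => by
          simp only [R, dyadicEnds_zero]
          exact (h01 a).2)
        (fun k => by simp only [R, dyadicEnds_left]) (fun k => by simp only [R, dyadicEnds_right]))
  exact AddCommGrpCat.hom_ext (AddMonoidHom.ext key)

/-! ### The estimates for c₀ and ℓ^p. -/

/-- Uniform continuity of functions on the unit interval that are continuous for `‖·‖_E`. -/
theorem IsDisk.exists_uniform_bound {V : Type*} [AddCommGroup V] [Module ℂ V] {E : Set V}
    (hE : IsDisk E) {f : unitInterval → V} (hf : ∀ t, f t ∈ diskSpan E)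
    (hcont : ∀ t, Tendsto (fun s => diskNorm E (f s - f t)) (𝓝 t) (𝓝 0)) {ε : ℝ} (hε : 0 < ε) :
    ∃ δ > 0, ∀ s t, dist s t < δ → diskNorm E (f s - f t) < ε := by
  have hnhds : ∀ t, {s | diskNorm E (f s - f t) < ε / 2} ∈ 𝓝 t := fun t =>
    (hcont t).eventually_lt_const (half_pos hε)
  obtain ⟨δ, hδ, h⟩ := lebesgue_number_lemma_of_metric (s := (Set.univ : Set unitInterval))
    (c := fun t => interior {s | diskNorm E (f s - f t) < ε / 2}) isCompact_univ
    (fun _ => isOpen_interior)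
    (fun t _ => Set.mem_iUnion.2 ⟨t, mem_interior_iff_mem_nhds.2 (hnhds t)⟩)
  refine ⟨δ, hδ, fun s t hst => ?_⟩
  obtain ⟨i, hi⟩ := h t (Set.mem_univ t)
  have hs : s ∈ {s | diskNorm E (f s - f i) < ε / 2} :=
    interior_subset (hi (Metric.mem_ball.2 hst))
  have ht : t ∈ {s | diskNorm E (f s - f i) < ε / 2} :=
    interior_subset (hi (Metric.mem_ball_self hδ))
  rw [Set.mem_ofPred_eq] at hs ht
  have hsum := hE.diskNorm_add_le (sub_mem (hf s) (hf i))
    (Submodule.smul_mem _ (-1 : ℂ) (sub_mem (hf t) (hf i)))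
  rw [hE.diskNorm_smul, norm_neg, norm_one, one_mul, neg_one_smul, ← sub_eq_add_neg,
    sub_sub_sub_cancel_right] at hsum
  linarith

/-- The double family indexed by (k, j) tends to zero: for large j the differences are small
uniformly in k, since `α j` is small, and for each remaining j they are small for large k by uniform
continuity. -/
theorem invariant_c0 {F : Alg.{u} ⥤ AddCommGrpCat.{v}} (hF : SplitExact F) (hM : M2Stable F) :
    InvariantUnderContinuousHomotopies (I.{u} c0 ⋙ F) := by
  rintro A B f₀ f₁ ⟨H, hH, h01⟩
  refine map_eq_of_dyadic_swindle hF hM c0 H (fun s hs => ?_) h01 fun α hα s t hst => ?_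
  · obtain ⟨E, hE, hE', hcont, C, hC⟩ := hH s hs
    refine isBounded_of_diskNorm_le hE hE'.toIsDisk (C := C) ?_ ?_
    · rintro _ ⟨x, hx, t, rfl⟩
      exact (hcont _ ⟨x, hx, rfl⟩).1 t
    · rintro _ ⟨x, hx, t, rfl⟩
      exact hC _ ⟨x, hx, rfl⟩ t
  obtain ⟨D, hD, hD', hαD, hα0⟩ := hα
  obtain ⟨E, hE, hE', hcont, C, hC⟩ := hH D hD
  have hspan : ∀ j t, H (α j) t ∈ diskSpan E := fun j t =>
    eval_mem_diskSpan H t (fun x hx => (hcont _ ⟨x, hx, rfl⟩).1 t) (hαD j)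
  refine ⟨E, hE, hE', fun n => sub_mem (hspan _ _) (hspan _ _), ?_⟩
  have hbound : ∀ j s t, diskNorm E (H (α j) s - H (α j) t) ≤ (C + C) * diskNorm D (α j) := by
    intro j s t
    refine hD'.toIsDisk.diskNorm_eval_sub_le H hE'.toIsDisk s t (fun x hx => ?_) (hαD j)
    have hx' := hcont _ ⟨x, hx, rfl⟩
    have hsum := hE'.toIsDisk.diskNorm_add_le (hx'.1 s)
      (Submodule.smul_mem _ (-1 : ℂ) (hx'.1 t))
    rw [hE'.toIsDisk.diskNorm_smul, norm_neg, norm_one, one_mul, neg_one_smul,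
      ← sub_eq_add_neg] at hsum
    exact hsum.trans (add_le_add (hC _ ⟨x, hx, rfl⟩ s) (hC _ ⟨x, hx, rfl⟩ t))
  have hcont' : ∀ j t, Tendsto (fun s => diskNorm E (H (α j) s - H (α j) t)) (𝓝 t) (𝓝 0) := by
    intro j t
    -- Continuity for ‖·‖_E is known on `D` only, and `α j` is a multiple of an element of `D`.
    obtain ⟨r, hr, d, hd, hdj⟩ := hD'.toIsDisk.exists_mem_smul (hαD j)
    have hdj' : (r : ℂ) • d = α j := by rw [Complex.coe_smul]; exact hdj
    have := ((hcont _ ⟨d, hd, rfl⟩).2 t).const_mul r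
    rw [mul_zero] at this
    refine this.congr fun s => ?_
    rw [← hdj', map_smul, Pi.smul_apply, Pi.smul_apply, ← smul_sub, hE'.toIsDisk.diskNorm_smul,
      Complex.norm_real, Real.norm_of_nonneg hr.le]
  change Tendsto _ atTop (𝓝 0) at hα0
  change Tendsto _ atTop (𝓝 0)
  rw [← Nat.cofinite_eq_atTop, Metric.tendsto_nhds]
  intro ε hε
  rw [Filter.eventually_cofinite]
  have hα1 : Tendsto (fun j => (C + C) * diskNorm D (α j)) atTop (𝓝 0) := by
    have := (tendsto_zero_iff_norm_tendsto_zero.1 hα0).const_mul (C + C)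
    rw [mul_zero] at this
    refine this.congr fun j => ?_
    rw [Complex.norm_real, Real.norm_of_nonneg (diskNorm_nonneg _ _)]
  obtain ⟨J, hJ⟩ := eventually_atTop.1 (hα1.eventually_lt_const hε)
  have hk : ∀ j, ∃ N : ℕ, ∀ k ≥ N, diskNorm E (H (α j) (s k) - H (α j) (t k)) < ε := by
    intro j
    obtain ⟨δ, hδ, h⟩ := hE'.toIsDisk.exists_uniform_bound (hspan j) (hcont' j) hε
    have hlim : Tendsto (fun k : ℕ => 2 / ((k : ℝ) + 2)) atTop (𝓝 0) :=
      (tendsto_natCast_atTop_atTop.atTop_add tendsto_const_nhds).const_div_atTop 2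
    obtain ⟨N, hN⟩ := eventually_atTop.1 (hlim.eventually_lt_const hδ)
    exact ⟨N, fun k hk => h _ _ ((hst k).trans_lt (hN k hk))⟩
  choose N hN using hk
  -- The exceptional pairs (k, j) satisfy j < J and k < `N j`, so they are finite in number.
  refine ((Set.finite_Iio J).biUnion fun j _ =>
    (Set.finite_Iio (N j)).image fun k => Nat.pair k j).subset fun n hn => ?_
  rw [Set.mem_ofPred_eq, dist_zero_right, Complex.norm_real,
    Real.norm_of_nonneg (diskNorm_nonneg _ _), not_lt] at hn
  simp only [Set.mem_iUnion]
  refine ⟨n.unpair.2, ?_, n.unpair.1, ?_, Nat.pair_unpair n⟩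
  · by_contra h
    exact absurd (hn.trans (hbound _ _ _)) (not_le.2 (hJ _ (not_lt.1 h)))
  · by_contra h
    exact absurd hn (not_le.2 (hN _ _ (not_lt.1 h)))

/-- The (k, j) term is at most C (2/(k+2))^r times the norm of `α j`. The p-th powers of this bound
form a product of two summable families. -/
theorem invariant_lp {F : Alg.{u} ⥤ AddCommGrpCat.{v}} (hF : SplitExact F) (hM : M2Stable F)
    {r p : ℝ} (hp : 0 < p) (hr : 0 < r) (hrp : 1 / r < p) :
    InvariantUnderHolderHomotopies r (I.{u} (lp p hp) ⋙ F) := by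
  rintro A B f₀ f₁ ⟨H, hH, h01⟩
  refine map_eq_of_dyadic_swindle hF hM (lp p hp) H (fun s hs => ?_) h01 fun α hα s t hst => ?_
  · obtain ⟨E, hE, hE', hspan, C, hC⟩ := hH s hs
    refine isBounded_of_diskNorm_le hE hE'.toIsDisk (C := C) ?_ ?_
    · rintro _ ⟨x, hx, t, rfl⟩
      exact hspan _ ⟨x, hx, rfl⟩ t
    · rintro _ ⟨x, hx, t, rfl⟩
      exact (hC _ ⟨x, hx, rfl⟩).1 t
  obtain ⟨D, hD, hD', hαD, hαp⟩ := hα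
  obtain ⟨E, hE, hE', hspan, C, hC⟩ := hH D hD
  have hspan' : ∀ j t, H (α j) t ∈ diskSpan E := fun j t =>
    eval_mem_diskSpan H t (fun x hx => hspan _ ⟨x, hx, rfl⟩ t) (hαD j)
  have hC0 : 0 ≤ C := by
    obtain ⟨x, hx⟩ := hD'.nonempty
    exact (diskNorm_nonneg _ _).trans ((hC _ ⟨x, hx, rfl⟩).1 0)
  refine ⟨E, hE, hE', fun n => sub_mem (hspan' _ _) (hspan' _ _), ?_⟩
  have hbound : ∀ j k, diskNorm E (H (α j) (s k) - H (α j) (t k)) ≤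
      C * (2 / ((k : ℝ) + 2)) ^ r * diskNorm D (α j) := by
    intro j k
    refine (hD'.toIsDisk.diskNorm_eval_sub_le H hE'.toIsDisk _ _
      (fun x hx => (hC _ ⟨x, hx, rfl⟩).2 (s k) (t k)) (hαD j)).trans ?_
    refine mul_le_mul_of_nonneg_right ?_ (diskNorm_nonneg _ _)
    exact mul_le_mul_of_nonneg_left (Real.rpow_le_rpow dist_nonneg (hst k) hr.le) hC0
  have hsum₁ : Summable fun k : ℕ => (C * (2 / ((k : ℝ) + 2)) ^ r) ^ p := by
    -- This is where 1/r < p is needed: the exponent r p of the series exceeds 1.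
    have h := ((Real.summable_one_div_nat_add_rpow 2 (r * p)).2
      (by rwa [div_lt_iff₀' hr] at hrp)).mul_left (C ^ p * 2 ^ (r * p))
    refine h.congr fun k => ?_
    have hk : (0 : ℝ) ≤ (k : ℝ) + 2 := by positivity
    rw [Real.mul_rpow hC0 (by positivity), ← Real.rpow_mul (by positivity),
      Real.div_rpow (by norm_num) hk, abs_of_nonneg hk]
    ring
  have hsum₂ : Summable fun j => diskNorm D (α j) ^ p := by
    refine (show Summable _ from hαp).congr fun j => ?_
    rw [Complex.norm_real, Real.norm_of_nonneg (diskNorm_nonneg _ _)]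
  have hprod := (hsum₁.mul_of_nonneg hsum₂ (fun k => by positivity)
    (fun j => Real.rpow_nonneg (diskNorm_nonneg _ _) _)).comp_injective Nat.pairEquiv.symm.injective
  refine Summable.of_nonneg_of_le (fun n => by positivity) (fun n => ?_) hprod
  rw [Complex.norm_real, Real.norm_of_nonneg (diskNorm_nonneg _ _)]
  refine (Real.rpow_le_rpow (diskNorm_nonneg _ _) (hbound _ _) hp.le).trans_eq ?_
  exact Real.mul_rpow (by positivity) (diskNorm_nonneg _ _)

end

end BornK

theorem theorem6p5 (F : BornK.Alg.{u} ⥤ AddCommGrpCat.{v})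
    (hsplit : BornK.SplitExact F) (hM2 : BornK.M2Stable F) :
    BornK.InvariantUnderContinuousHomotopies (BornK.I.{u} BornK.c0 ⋙ F) ∧
    ∀ (r p : ℝ) (hp : 0 < p), 0 < r → r ≤ 1 → 1 / r < p →
      BornK.InvariantUnderHolderHomotopies r (BornK.I.{u} (BornK.lp p hp) ⋙ F) :=
  ⟨BornK.invariant_c0 hsplit hM2, fun _ _ hp hr _ hrp => BornK.invariant_lp hsplit hM2 hp hr hrp⟩
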